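/- Let $k$ be a commutative ring, let $\mathcal A$ be a finitely generated associative unital $k$-algebra, and let $n\ge 1$. For a $k$-scheme $X$ let $\mathcal A_X$ be the sheaf of $\mathcal O_X$-algebras associated to the presheaf $U\mapsto \mathcal O_X(U)\otimes_k\mathcal A$. Let $\tilde{\mathbf M}^{[n]}_{\mathcal A}$ be the contravariant functor from $k$-schemes to sets that sends $X$ to the set of equivalence classes of triples $(M,v,B)$, where $M$ is a left $\mathcal A_X$-module that is free of rank $n$ as an $\mathcal O_X$-module, $v\in\Gamma(X,M)$ generates $M$ as an $\mathcal A_X$-module (that is, the map of sheaves $\mathcal A_X\to M$, $a\mapsto av$, is surjective), and $B=(b_1,\dots,b_n)$, $b_i\in\Gamma(X,M)$, is an ordered basis of the $\mathcal O_X$-module $M$. Two triples are equivalent if there is an isomorphism of $\mathcal A_X$-modules that carries generator to generator and basis to basis. The functor acts on morphisms by pullback of triples. The functor $\tilde{\mathbf M}^{[n]}_{\mathcal A}$ is represented by a quasi-affine $k$-scheme $\tilde{\mathbf H}^{[n]}_{\mathcal A}$, and if $k$ is noetherian, then $\tilde{\mathbf H}^{[n]}_{\mathcal A}$ is of finite type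 over $k$. Explicitly, let $F_m=k\langle x_1,\dots,x_m\rangle\to\mathcal A$ be any surjective homomorphism of $k$-algebras, with kernel $\mathcal R$. Let $A_s=(t^s_{ij})_{1\le i,j\le n}$, $1\le s\le m$, be matrices of indeterminates, let $\mathrm{Rep}^{[n]}_{\mathcal A}\subset\operatorname{Spec}k[t^s_{ij}]$ be the closed subscheme defined by the vanishing of all entries of the matrices $r(A_1,\dots,A_m)$, $r\in\mathcal R$, and let $Y=(y_1,\dots,y_n)^t$ be the column of coordinates on $\mathbb A^n=\operatorname{Spec}k[y_1,\dots,y_n]$. For $f=(f_1,\dots,f_{n-1})\in F_m^{\,n-1}$ put $$D_f=\det\bigl(Y,\ f_1(A_1,\dots,A_m)Y,\ \dots,\ f_{n-1}(A_1,\dots,A_m)Y\bigr).$$ Then the open subscheme $\bigcup_f\{D_f\neq 0\}$ of $\mathrm{Rep}^{[n]}_{\mathcal A}\times_k\mathbb A^n$ is quasi-affine, represents $\tilde{\mathbf M}^{[n]}_{\mathcal A}$, and is of finite type over $k$ if $k$ is noetherian. -/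

import Mathlib

open CategoryTheory AlgebraicGeometry Opposite TopologicalSpace TensorProduct

universe u

namespace BasedHilb

/-- The category of `k`-schemes. -/
abbrev Sch (k : Type u) [CommRing k] := Over (Spec (CommRingCat.of k))

section
variable {k : Type u} [CommRing k]

/-- The structure map `k → 𝒪_X(U)` of a `k`-scheme `X`. -/
noncomputable def structureMap (X : Sch k) (U : X.left.Opens) : k →+* Γ(X.left, U) :=
  ((Scheme.ΓSpecIso (CommRingCat.of k)).inv ≫ X.hom.appTop ≫
    X.left.presheaf.map (homOfLE (le_top : U ≤ ⊤)).op).hom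

/-- `𝒪_X(U)` is a `k`-algebra, through the structure morphism of `X`. -/
noncomputable instance sectionsAlgebra (X : Sch k) (U : X.left.Opens) :
    Algebra k Γ(X.left, U) := (structureMap X U).toAlgebra

theorem map_structureMap (X : Sch k) {U V : X.left.Opens} (i : V ⟶ U) (r : k) :
    X.left.presheaf.map i.op (structureMap X U r) = structureMap X V r := by
  have h : (homOfLE (le_top : U ≤ ⊤)).op ≫ i.op = (homOfLE (le_top : V ≤ ⊤)).op := rfl
  simp only [structureMap, ← h, Functor.map_comp]
  simp

theorem app_structureMap {X Y : Sch k} (f : Y ⟶ X) (U : X.left.Opens) (r : k) :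
    f.left.app U (structureMap X U r) = structureMap Y (f.left ⁻¹ᵁ U) r := by
  have h := Over.w f
  simp only [structureMap, ← h]
  simp only [CommRingCat.hom_comp, RingHom.coe_comp, Function.comp_apply, Scheme.Hom.comp_appTop]
  generalize ((ConcreteCategory.hom (Scheme.Hom.appTop X.hom)) _) = z
  exact ConcreteCategory.congr_hom (f.left.naturality (homOfLE (le_top : U ≤ ⊤)).op) z

/-- Restriction `𝒪_X(U) → 𝒪_X(V)`, as a map of `k`-algebras. -/
noncomputable def restrictSections (X : Sch k) {U V : X.left.Opens} (i : V ⟶ U) :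
    Γ(X.left, U) →ₐ[k] Γ(X.left, V) where
  __ := (X.left.presheaf.map i.op).hom
  commutes' r := map_structureMap X i r

/-- The map `𝒪_X(U) → 𝒪_Y(f⁻¹ U)` of `k`-algebras given by a morphism of `k`-schemes. -/
noncomputable def pullbackSections {X Y : Sch k} (f : Y ⟶ X) (U : X.left.Opens) :
    Γ(X.left, U) →ₐ[k] Γ(Y.left, f.left ⁻¹ᵁ U) where
  __ := (f.left.app U).hom
  commutes' r := app_structureMap f U r

variable (A : Type u) [Ring A] [Algebra k A]

/-- The presheaf of rings `U ↦ 𝒪_X(U) ⊗[k] A`. -/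
noncomputable def presheafTensor (X : Sch k) : (X.left.Opens)ᵒᵖ ⥤ RingCat.{u} where
  obj U := RingCat.of (Γ(X.left, U.unop) ⊗[k] A)
  map i := RingCat.ofHom
    (Algebra.TensorProduct.map (restrictSections X i.unop) (AlgHom.id k A)).toRingHom
  map_id U := by
    have h : restrictSections X (𝟙 U.unop) = AlgHom.id k _ := by
      ext x
      exact ConcreteCategory.congr_hom (X.left.presheaf.map_id U) x
    simp only [unop_id, h, Algebra.TensorProduct.map_id]
    rfl
  map_comp {U V W} i j := by
    have h : restrictSections X (j.unop ≫ i.unop) =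
        (restrictSections X j.unop).comp (restrictSections X i.unop) := by
      ext x
      exact ConcreteCategory.congr_hom (X.left.presheaf.map_comp i j) x
    simp only [unop_comp, h]
    rw [← AlgHom.comp_id (AlgHom.id k A), Algebra.TensorProduct.map_comp]
    rfl

/-- The sheaf of rings `A_X` associated to the presheaf `𝒪_X ⊗[k] A`. -/
noncomputable def algebraSheaf (X : Sch k) :
    Sheaf (Opens.grothendieckTopology X.left) RingCat.{u} :=
  (presheafToSheaf _ _).obj (presheafTensor A X)

/-- The canonical map from `𝒪_X ⊗[k] A` to its sheafification `A_X`. -/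
noncomputable def toAlgebraSheaf (X : Sch k) : presheafTensor A X ⟶ (algebraSheaf A X).obj :=
  toSheafify _ (presheafTensor A X)

/-- The universal property of the sheafification `A_X`. -/
noncomputable def algebraSheafDesc (X : Sch k)
    (R : Sheaf (Opens.grothendieckTopology X.left) RingCat.{u})
    (φ : presheafTensor A X ⟶ R.obj) : algebraSheaf A X ⟶ R :=
  ((sheafificationAdjunction _ _).homEquiv _ _).symm φ

theorem toAlgebraSheaf_desc (X : Sch k)
    (R : Sheaf (Opens.grothendieckTopology X.left) RingCat.{u})
    (φ : presheafTensor A X ⟶ R.obj) :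
    toAlgebraSheaf A X ≫ (algebraSheafDesc A X R φ).hom = φ := by
  have := ((sheafificationAdjunction (Opens.grothendieckTopology X.left)
    RingCat.{u}).homEquiv_apply _ _ (algebraSheafDesc A X R φ))
  rw [algebraSheafDesc, Equiv.apply_symm_apply] at this
  exact this.symm

/-- The map `𝒪_X ⊗ A → f_* (𝒪_Y ⊗ A)`, `s ⊗ a ↦ f^#(s) ⊗ a`. -/
noncomputable def presheafTensorMap {X Y : Sch k} (f : Y ⟶ X) :
    presheafTensor A X ⟶ (Opens.map f.left.base).op ⋙ presheafTensor A Y where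
  app U := RingCat.ofHom
    (Algebra.TensorProduct.map (pullbackSections f U.unop) (AlgHom.id k A)).toRingHom
  naturality U V i := by
    have h : (pullbackSections f V.unop).comp (restrictSections X i.unop) =
        (restrictSections Y ((Opens.map f.left.base).map i.unop)).comp
          (pullbackSections f U.unop) := by
      ext x
      exact ConcreteCategory.congr_hom (f.left.naturality i) x
    have h' : (Algebra.TensorProduct.map (pullbackSections f V.unop) (AlgHom.id k A)).comp
        (Algebra.TensorProduct.map (restrictSections X i.unop) (AlgHom.id k A)) =
        (Algebra.TensorProduct.map (restrictSections Y ((Opens.map f.left.base).map i.unop))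
          (AlgHom.id k A)).comp
          (Algebra.TensorProduct.map (pullbackSections f U.unop) (AlgHom.id k A)) := by
      rw [← Algebra.TensorProduct.map_comp, ← Algebra.TensorProduct.map_comp, h]
    exact congrArg (fun g => RingCat.ofHom (AlgHom.toRingHom g)) h'

/-- The map of sheaves of rings `A_X → f_* A_Y` induced by a morphism `f : Y ⟶ X` of `k`-schemes. -/
noncomputable def algebraSheafMap {X Y : Sch k} (f : Y ⟶ X) : algebraSheaf A X ⟶
    ((Opens.map f.left.base).sheafPushforwardContinuous RingCat.{u} _
      (Opens.grothendieckTopology Y.left)).obj (algebraSheaf A Y) :=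
  algebraSheafDesc A X _
    (presheafTensorMap A f ≫ (Opens.map f.left.base).op.whiskerLeft (toAlgebraSheaf A Y))

/-- The map `𝒪_X(U) → A_X(U)`, `s ↦ s ⊗ 1`, through which an `A_X`-module is an `𝒪_X`-module. -/
noncomputable def fromFunctions (X : Sch k) (U : X.left.Opens) :
    Γ(X.left, U) →+* (algebraSheaf A X).obj.obj (op U) :=
  ((toAlgebraSheaf A X).app (op U)).hom.comp Algebra.TensorProduct.includeLeftRingHom

/-- The map `A → A_X(U)`, `a ↦ 1 ⊗ a`. -/
noncomputable def fromAlgebra (X : Sch k) (U : X.left.Opens) :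
    A →+* (algebraSheaf A X).obj.obj (op U) :=
  ((toAlgebraSheaf A X).app (op U)).hom.comp
    (Algebra.TensorProduct.includeRight : A →ₐ[k] Γ(X.left, U) ⊗[k] A).toRingHom

theorem map_fromFunctions (X : Sch k) {U V : X.left.Opens} (i : V ⟶ U) (s : Γ(X.left, U)) :
    (algebraSheaf A X).obj.map i.op (fromFunctions A X U s) =
      fromFunctions A X V (X.left.presheaf.map i.op s) := by
  refine (ConcreteCategory.congr_hom ((toAlgebraSheaf A X).naturality i.op) (s ⊗ₜ[k] (1 : A))).symm.trans ?_
  exact congrArg ((toAlgebraSheaf A X).app (op V)).hom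
    ((Algebra.TensorProduct.map_tmul (restrictSections X i) (AlgHom.id k A) s 1).trans rfl)
theorem map_fromAlgebra (X : Sch k) {U V : X.left.Opens} (i : V ⟶ U) (a : A) :
    (algebraSheaf A X).obj.map i.op (fromAlgebra A X U a) = fromAlgebra A X V a := by
  refine (ConcreteCategory.congr_hom ((toAlgebraSheaf A X).naturality i.op) ((1 : Γ(X.left, U)) ⊗ₜ[k] a)).symm.trans ?_
  exact congrArg ((toAlgebraSheaf A X).app (op V)).hom
    ((Algebra.TensorProduct.map_tmul (restrictSections X i) (AlgHom.id k A) 1 a).trans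
      (congrArg (· ⊗ₜ[k] a) (map_one (restrictSections X i))))

theorem algebraSheafMap_fromFunctions {X Y : Sch k} (f : Y ⟶ X) (U : X.left.Opens) (s : Γ(X.left, U)) :
    (algebraSheafMap A f).hom.app (op U) (fromFunctions A X U s) =
      fromFunctions A Y (f.left ⁻¹ᵁ U) (f.left.app U s) := by
  refine (ConcreteCategory.congr_hom (congr_app (toAlgebraSheaf_desc A X _ _) (op U)) (s ⊗ₜ[k] (1 : A))).trans ?_
  exact congrArg ((toAlgebraSheaf A Y).app (op (f.left ⁻¹ᵁ U))).hom
    ((Algebra.TensorProduct.map_tmul (pullbackSections f U) (AlgHom.id k A) s 1).trans rfl)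

theorem algebraSheafMap_fromAlgebra {X Y : Sch k} (f : Y ⟶ X) (U : X.left.Opens) (a : A) :
    (algebraSheafMap A f).hom.app (op U) (fromAlgebra A X U a) =
      fromAlgebra A Y (f.left ⁻¹ᵁ U) a := by
  refine (ConcreteCategory.congr_hom (congr_app (toAlgebraSheaf_desc A X _ _) (op U)) ((1 : Γ(X.left, U)) ⊗ₜ[k] a)).trans ?_
  exact congrArg ((toAlgebraSheaf A Y).app (op (f.left ⁻¹ᵁ U))).hom
    ((Algebra.TensorProduct.map_tmul (pullbackSections f U) (AlgHom.id k A) 1 a).trans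
      (congrArg (· ⊗ₜ[k] a) (map_one (pullbackSections f U))))
end

section
variable {k : Type u} [CommRing k] {A : Type u} [Ring A] [Algebra k A]

variable (A) in
/-- The category of sheaves of left `A_X`-modules. -/
abbrev AlgebraModules (X : Sch k) := SheafOfModules.{u} (algebraSheaf A X)

/-- Restriction of sections of an `A_X`-module. -/
noncomputable def restrict {X : Sch k} (M : AlgebraModules A X) {U V : X.left.Opens}
    (h : V ≤ U) : M.val.obj (op U) →+ M.val.obj (op V) :=
  AddMonoidHom.mk' (M.val.map (homOfLE h).op) (map_add (M.val.map (homOfLE h).op).hom)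

theorem restrict_self {X : Sch k} (M : AlgebraModules A X) {U : X.left.Opens}
    (m : M.val.obj (op U)) : restrict M le_rfl m = m :=
  ConcreteCategory.congr_hom (M.val.presheaf.map_id (op U)) m

theorem restrict_restrict {X : Sch k} (M : AlgebraModules A X) {U V W : X.left.Opens}
    (h : V ≤ U) (h' : W ≤ V) (m : M.val.obj (op U)) :
    restrict M h' (restrict M h m) = restrict M (h'.trans h) m :=
  (ConcreteCategory.congr_hom (M.val.presheaf.map_comp (homOfLE h).op (homOfLE h').op) m).symm

theorem restrict_smul {X : Sch k} (M : AlgebraModules A X) {U V : X.left.Opens}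
    (h : V ≤ U) (r : (algebraSheaf A X).obj.obj (op U)) (m : M.val.obj (op U)) :
    restrict M h (r • m) = (algebraSheaf A X).obj.map (homOfLE h).op r • restrict M h m :=
  M.val.map_smul _ _ _

theorem restrict_fromFunctions_smul {X : Sch k} (M : AlgebraModules A X) {U V : X.left.Opens}
    (h : V ≤ U) (s : Γ(X.left, U)) (m : M.val.obj (op U)) :
    restrict M h (fromFunctions A X U s • m) =
      fromFunctions A X V (X.left.presheaf.map (homOfLE h).op s) • restrict M h m := by
  rw [restrict_smul, map_fromFunctions]

theorem restrict_fromAlgebra_smul {X : Sch k} (M : AlgebraModules A X) {U V : X.left.Opens}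
    (h : V ≤ U) (a : A) (m : M.val.obj (op U)) :
    restrict M h (fromAlgebra A X U a • m) = fromAlgebra A X V a • restrict M h m := by
  rw [restrict_smul, map_fromAlgebra]

theorem hom_restrict {X : Sch k} {M N : AlgebraModules A X} (g : M ⟶ N) {U V : X.left.Opens}
    (h : V ≤ U) (m : M.val.obj (op U)) :
    (g.val.app (op V)).hom (restrict M h m) = restrict N h ((g.val.app (op U)).hom m) :=
  PresheafOfModules.naturality_apply g.val (homOfLE h).op m

theorem toAlgebraSheaf_tmul (X : Sch k) (U : X.left.Opens) (s : Γ(X.left, U)) (a : A) :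
    (toAlgebraSheaf A X).app (op U) (s ⊗ₜ[k] a) =
      fromFunctions A X U s * fromAlgebra A X U a := by
  refine Eq.trans ?_ (map_mul ((toAlgebraSheaf A X).app (op U)).hom (s ⊗ₜ[k] (1 : A))
    ((1 : Γ(X.left, U)) ⊗ₜ[k] a))
  refine congrArg ((toAlgebraSheaf A X).app (op U)).hom ?_
  refine Eq.trans ?_ (Algebra.TensorProduct.tmul_mul_tmul s 1 1 a).symm
  rw [mul_one, one_mul]

theorem map_smul_of_map_smul {X : Sch k} (M N : AlgebraModules A X)
    (g : ∀ U : X.left.Opens, M.val.obj (op U) →+ N.val.obj (op U))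
    (nat : ∀ (U V : X.left.Opens) (h : V ≤ U) (m : M.val.obj (op U)),
      g V (restrict M h m) = restrict N h (g U m))
    (hs : ∀ (U : X.left.Opens) (s : Γ(X.left, U)) (m : M.val.obj (op U)),
      g U (fromFunctions A X U s • m) = fromFunctions A X U s • g U m)
    (ha : ∀ (U : X.left.Opens) (a : A) (m : M.val.obj (op U)),
      g U (fromAlgebra A X U a • m) = fromAlgebra A X U a • g U m)
    (U : X.left.Opens) (r : (algebraSheaf A X).obj.obj (op U)) (m : M.val.obj (op U)) :
    g U (r • m) = r • g U m := by
  have key : ∀ (V : X.left.Opens) (t : Γ(X.left, V) ⊗[k] A) (m : M.val.obj (op V)),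
      g V (((toAlgebraSheaf A X).app (op V)).hom t • m) =
        ((toAlgebraSheaf A X).app (op V)).hom t • g V m := by
    intro V t m
    induction t using TensorProduct.induction_on with
    | zero =>
      have h0 : ((toAlgebraSheaf A X).app (op V)).hom (0 : Γ(X.left, V) ⊗[k] A) = 0 :=
        map_zero ((toAlgebraSheaf A X).app (op V)).hom
      rw [h0, zero_smul, zero_smul, map_zero]
    | tmul s a =>
      have h0 := toAlgebraSheaf_tmul (A := A) X V s a
      erw [h0]
      rw [mul_smul, mul_smul, hs, ha]
    | add x y hx hy =>
      have h0 : ((toAlgebraSheaf A X).app (op V)).hom (x + y : Γ(X.left, V) ⊗[k] A) =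
          ((toAlgebraSheaf A X).app (op V)).hom x + ((toAlgebraSheaf A X).app (op V)).hom y :=
        map_add ((toAlgebraSheaf A X).app (op V)).hom x y
      rw [h0, add_smul, add_smul, map_add, hx, hy]
  have hloc : Presheaf.IsLocallySurjective (Opens.grothendieckTopology X.left)
      (toAlgebraSheaf A X) :=
    inferInstanceAs (Presheaf.IsLocallySurjective (Opens.grothendieckTopology X.left)
      (toSheafify (Opens.grothendieckTopology X.left) (presheafTensor A X)))
  refine N.isSheaf.isSeparated _ _
    (Presheaf.imageSieve_mem (Opens.grothendieckTopology X.left) (toAlgebraSheaf A X) r) _ _ ?_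
  rintro V p ⟨t, ht⟩
  change restrict N p.le (g U (r • m)) = restrict N p.le (r • g U m)
  rw [← nat, restrict_smul, restrict_smul, ← nat]
  have ht' : (algebraSheaf A X).obj.map (homOfLE p.le).op r =
      ((toAlgebraSheaf A X).app (op V)).hom t := ht.symm
  rw [ht']
  exact key V t _

/-- An additive map of sheaves that is linear over the images of `𝒪_X` and of `A` is a map of
`A_X`-modules. -/
noncomputable def mkHom {X : Sch k} (M N : AlgebraModules A X)
    (g : ∀ U : X.left.Opens, M.val.obj (op U) →+ N.val.obj (op U))
    (nat : ∀ (U V : X.left.Opens) (h : V ≤ U) (m : M.val.obj (op U)),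
      g V (restrict M h m) = restrict N h (g U m))
    (hs : ∀ (U : X.left.Opens) (s : Γ(X.left, U)) (m : M.val.obj (op U)),
      g U (fromFunctions A X U s • m) = fromFunctions A X U s • g U m)
    (ha : ∀ (U : X.left.Opens) (a : A) (m : M.val.obj (op U)),
      g U (fromAlgebra A X U a • m) = fromAlgebra A X U a • g U m) : M ⟶ N where
  val := PresheafOfModules.homMk
    { app := fun U => AddCommGrpCat.ofHom (g U.unop)
      naturality := fun U V i => by
        ext m
        exact nat U.unop V.unop i.unop.le m }
    (fun U r m => map_smul_of_map_smul M N g nat hs ha U.unop r m)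

theorem mkHom_app {X : Sch k} (M N : AlgebraModules A X) (g nat hs ha) (U : X.left.Opens)
    (m : M.val.obj (op U)) : ((mkHom M N g nat hs ha).val.app (op U)).hom m = g U m := rfl

variable (A) in
instance isRightAdjoint_pushforward {X Y : Sch k} (f : Y ⟶ X) :
    (SheafOfModules.pushforward.{u} (algebraSheafMap A f)).IsRightAdjoint := by
  have aux : ∀ {C D : Type u} [SmallCategory C] [SmallCategory D] {F : C ⥤ D}
      {R : Dᵒᵖ ⥤ RingCat.{u}} {S : Cᵒᵖ ⥤ RingCat.{u}} (φ : S ⟶ F.op ⋙ R),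
      (PresheafOfModules.pushforward.{u} φ).IsRightAdjoint := fun _ => inferInstance
  have : (PresheafOfModules.pushforward.{u} (algebraSheafMap A f).hom).IsRightAdjoint :=
    aux (F := Opens.map f.left.base) (R := (algebraSheaf A Y).obj) (S := (algebraSheaf A X).obj)
      (algebraSheafMap A f).hom
  infer_instance

/-- The `A_X`-module `f_* N`. -/
noncomputable abbrev pushforwardModule {X Y : Sch k} (f : Y ⟶ X) (N : AlgebraModules A Y) :
    AlgebraModules A X :=
  (SheafOfModules.pushforward.{u} (algebraSheafMap A f)).obj N

/-- The pullback of an `A_X`-module `M` along `f : Y ⟶ X`, that is, the `A_Y`-module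
`A_Y ⊗_{f⁻¹ A_X} f⁻¹ M`. Since `A_Y = 𝒪_Y ⊗_{f⁻¹ 𝒪_X} f⁻¹ A_X`, its underlying `𝒪_Y`-module is
`𝒪_Y ⊗_{f⁻¹ 𝒪_X} f⁻¹ M`. -/
noncomputable abbrev pullbackModule {X Y : Sch k} (f : Y ⟶ X) (M : AlgebraModules A X) :
    AlgebraModules A Y :=
  (SheafOfModules.pullback.{u} (algebraSheafMap A f)).obj M

/-- The pullback `f^* m`, a section over `f⁻¹ U`, of a section `m` of `M` over `U`. -/
noncomputable def pullbackSection {X Y : Sch k} (f : Y ⟶ X) (M : AlgebraModules A X)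
    {U : X.left.Opens} (m : M.val.obj (op U)) :
    (pullbackModule f M).val.obj (op (f.left ⁻¹ᵁ U)) :=
  (((SheafOfModules.pullbackPushforwardAdjunction.{u} (algebraSheafMap A f)).unit.app
    M).val.app (op U)).hom m

theorem pushforwardModule_fromFunctions_smul {X Y : Sch k} (f : Y ⟶ X) (N : AlgebraModules A Y)
    (U : X.left.Opens) (s : Γ(X.left, U)) (m : N.val.obj (op (f.left ⁻¹ᵁ U))) :
    fromFunctions A X U s • (show (pushforwardModule f N).val.obj (op U) from m) =
      fromFunctions A Y (f.left ⁻¹ᵁ U) (f.left.app U s) • m := by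
  rw [← algebraSheafMap_fromFunctions]
  rfl

theorem pushforwardModule_fromAlgebra_smul {X Y : Sch k} (f : Y ⟶ X) (N : AlgebraModules A Y)
    (U : X.left.Opens) (a : A) (m : N.val.obj (op (f.left ⁻¹ᵁ U))) :
    fromAlgebra A X U a • (show (pushforwardModule f N).val.obj (op U) from m) =
      fromAlgebra A Y (f.left ⁻¹ᵁ U) a • m := by
  rw [← algebraSheafMap_fromAlgebra]
  rfl

theorem pushforwardModule_restrict {X Y : Sch k} (f : Y ⟶ X) (N : AlgebraModules A Y)
    {U V : X.left.Opens} (h : V ≤ U) (m : N.val.obj (op (f.left ⁻¹ᵁ U))) :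
    restrict (pushforwardModule f N) h m =
      restrict N (show f.left ⁻¹ᵁ V ≤ f.left ⁻¹ᵁ U from fun _ hy => h hy) m := rfl

variable (A) in
/-- A triple `(M, v, B)` over `X`: a left `A_X`-module `M` with a basis `B = (B 0, …, B (n-1))` of
`M` as an `𝒪_X`-module, consisting of global sections (so `M` is free of rank `n` over `𝒪_X`), and
a global section `v` that generates `M` as an `A_X`-module. -/
structure Triple (n : ℕ) (X : Sch k) where
  /-- the module -/
  M : AlgebraModules A X
  /-- the generator -/
  v : M.val.obj (op ⊤)
  /-- the basis -/
  B : Fin n → M.val.obj (op ⊤)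
  /-- The sections `B i` form an `𝒪_X`-basis: `𝒪_X^n → M` is bijective over every open set. -/
  basis : ∀ U : X.left.Opens, Function.Bijective fun c : Fin n → Γ(X.left, U) =>
    ∑ i, fromFunctions A X U (c i) • restrict M (le_top : U ≤ ⊤) (B i)
  /-- The map of sheaves `A_X → M`, `a ↦ a v`, is surjective: every section of `M` is locally a
  multiple of `v`. -/
  generates : ∀ (U : X.left.Opens) (m : M.val.obj (op U)), ∀ x ∈ U,
    ∃ (V : X.left.Opens) (h : V ≤ U) (a : (algebraSheaf A X).obj.obj (op V)),
      x ∈ V ∧ a • restrict M (le_top : V ≤ ⊤) v = restrict M h m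

end

/-- A presheaf that is a power of a sheaf of sets is a sheaf. -/
theorem isSheaf_of_equiv_pi {C : Type u} [Category.{u} C] {J : GrothendieckTopology C}
    {ι : Type} {F G : Cᵒᵖ ⥤ Type u} (hF : Presieve.IsSheaf J F)
    (e : ∀ U : Cᵒᵖ, G.obj U ≃ (ι → F.obj U))
    (he : ∀ {U V : Cᵒᵖ} (i : U ⟶ V) (x : G.obj U) (j : ι), e V (G.map i x) j = F.map i (e U x j)) :
    Presieve.IsSheaf J G := by
  intro U S hS x hx
  have hc : ∀ j : ι, Presieve.FamilyOfElements.Compatible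
      (fun V i hi => e (op V) (x i hi) j : Presieve.FamilyOfElements F S.arrows) := by
    intro j V₁ V₂ W g₁ g₂ f₁ f₂ h₁ h₂ hw
    simp only [← he]
    rw [hx g₁ g₂ h₁ h₂ hw]
  choose t ht hu using fun j => hF S hS _ (hc j)
  refine ⟨(e (op U)).symm t, ?_, ?_⟩
  · intro V i hi
    apply (e (op V)).injective
    funext j
    rw [he, Equiv.apply_symm_apply]
    exact ht j i hi
  · intro t' ht'
    apply (e (op U)).injective
    funext j
    rw [Equiv.apply_symm_apply]
    refine hu j _ ?_
    intro V i hi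
    rw [← he, ht' i hi]

section
variable {k : Type u} [CommRing k] {A : Type u} [Ring A] [Algebra k A] {n : ℕ}

theorem isSheaf_functions (X : Sch k) : Presieve.IsSheaf (Opens.grothendieckTopology X.left)
    (X.left.presheaf ⋙ forget CommRingCat.{u}) :=
  (isSheaf_iff_isSheaf_of_type _ _).1
    ((Presheaf.isSheaf_iff_isSheaf_forget _ _ (forget CommRingCat.{u})).1 X.left.sheaf.property)

/-- The sheaf of rings `U ↦ Mat_n(𝒪_X(U))`. -/
noncomputable def matrixSheaf (n : ℕ) (X : Sch k) :
    Sheaf (Opens.grothendieckTopology X.left) RingCat.{u} where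
  obj :=
    { obj := fun U => RingCat.of (Matrix (Fin n) (Fin n) Γ(X.left, U.unop))
      map := fun i => RingCat.ofHom (X.left.presheaf.map i).hom.mapMatrix
      map_id := fun U => by ext x a b; simp
      map_comp := fun i j => by ext x a b; simp }
  property := by
    refine (Presheaf.isSheaf_iff_isSheaf_forget _ _ (forget RingCat.{u})).2
      ((isSheaf_iff_isSheaf_of_type _ _).2 ?_)
    exact isSheaf_of_equiv_pi (ι := Fin n × Fin n) (isSheaf_functions X)
      (fun U => (Equiv.curry _ _ _).symm) (fun i x j => rfl)

noncomputable def presheafTensorToMatrix {X : Sch k}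
    (σ : A →ₐ[k] Matrix (Fin n) (Fin n) Γ(X.left, ⊤)) (U : X.left.Opens) :
    Γ(X.left, U) ⊗[k] A →ₐ[k] Matrix (Fin n) (Fin n) Γ(X.left, U) :=
  Algebra.TensorProduct.lift (IsScalarTower.toAlgHom k _ _)
    ((restrictSections X (homOfLE (le_top : U ≤ ⊤))).mapMatrix.comp σ)
    (fun s _ => Algebra.commutes s _)

theorem presheafTensorToMatrix_tmul {X : Sch k}
    (σ : A →ₐ[k] Matrix (Fin n) (Fin n) Γ(X.left, ⊤)) (U : X.left.Opens)
    (s : Γ(X.left, U)) (a : A) : presheafTensorToMatrix σ U (s ⊗ₜ a) =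
      s • (σ a).map (X.left.presheaf.map (homOfLE (le_top : U ≤ ⊤)).op) := by
  rw [Algebra.smul_def]
  exact Algebra.TensorProduct.lift_tmul _ _ _ _ _

/-- A matrix representation `σ` of `A` over `𝒪_X(X)` extends to `A_X → Mat_n(𝒪_X)`. -/
noncomputable def algebraSheafToMatrix {X : Sch k}
    (σ : A →ₐ[k] Matrix (Fin n) (Fin n) Γ(X.left, ⊤)) : algebraSheaf A X ⟶ matrixSheaf n X :=
  algebraSheafDesc A X _
    { app := fun U => RingCat.ofHom (presheafTensorToMatrix σ U.unop).toRingHom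
      naturality := fun U V i => by
        have h : (presheafTensorToMatrix σ V.unop).comp
            (Algebra.TensorProduct.map (restrictSections X i.unop) (AlgHom.id k A)) =
            (restrictSections X i.unop).mapMatrix.comp (presheafTensorToMatrix σ U.unop) := by
          apply Algebra.TensorProduct.ext'
          intro s a
          simp only [AlgHom.comp_apply, Algebra.TensorProduct.map_tmul, AlgHom.id_apply]
          rw [presheafTensorToMatrix_tmul, presheafTensorToMatrix_tmul]
          ext p q
          have h1 : X.left.presheaf.map (homOfLE (le_top : V.unop ≤ ⊤)).op =
            X.left.presheaf.map (homOfLE (le_top : U.unop ≤ ⊤)).op ≫ X.left.presheaf.map i :=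
              X.left.presheaf.map_comp _ _
          simp only [Matrix.smul_apply, Matrix.map_apply, AlgHom.mapMatrix_apply, h1, smul_eq_mul,
            map_mul]
          rfl
        exact congrArg (fun g => RingCat.ofHom (AlgHom.toRingHom g)) h }

noncomputable def toMatrix {X : Sch k} (σ : A →ₐ[k] Matrix (Fin n) (Fin n) Γ(X.left, ⊤))
    (U : X.left.Opens) :
    (algebraSheaf A X).obj.obj (op U) →+* Matrix (Fin n) (Fin n) Γ(X.left, U) :=
  ((algebraSheafToMatrix σ).hom.app (op U)).hom

theorem toMatrix_toAlgebraSheaf {X : Sch k} (σ : A →ₐ[k] Matrix (Fin n) (Fin n) Γ(X.left, ⊤))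
    (U : X.left.Opens) (t : Γ(X.left, U) ⊗[k] A) :
    toMatrix σ U (((toAlgebraSheaf A X).app (op U)).hom t) = presheafTensorToMatrix σ U t :=
  ConcreteCategory.congr_hom (congr_app (toAlgebraSheaf_desc A X _ _) (op U)) t

theorem toMatrix_fromFunctions {X : Sch k} (σ : A →ₐ[k] Matrix (Fin n) (Fin n) Γ(X.left, ⊤))
    (U : X.left.Opens) (s : Γ(X.left, U)) :
    toMatrix σ U (fromFunctions A X U s) = s • 1 := by
  refine (toMatrix_toAlgebraSheaf σ U (s ⊗ₜ[k] (1 : A))).trans ?_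
  rw [presheafTensorToMatrix_tmul, map_one]
  congr 1
  exact map_one (X.left.presheaf.map (homOfLE (le_top : U ≤ ⊤)).op).hom.mapMatrix

theorem toMatrix_fromAlgebra {X : Sch k} (σ : A →ₐ[k] Matrix (Fin n) (Fin n) Γ(X.left, ⊤))
    (U : X.left.Opens) (a : A) :
    toMatrix σ U (fromAlgebra A X U a) =
      (σ a).map (X.left.presheaf.map (homOfLE (le_top : U ≤ ⊤)).op) := by
  refine (toMatrix_toAlgebraSheaf σ U ((1 : Γ(X.left, U)) ⊗ₜ[k] a)).trans ?_
  rw [presheafTensorToMatrix_tmul, one_smul]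

theorem toMatrix_map {X : Sch k} (σ : A →ₐ[k] Matrix (Fin n) (Fin n) Γ(X.left, ⊤))
    {U V : X.left.Opens} (i : V ⟶ U) (r : (algebraSheaf A X).obj.obj (op U)) :
    toMatrix σ V ((algebraSheaf A X).obj.map i.op r) =
      (toMatrix σ U r).map (X.left.presheaf.map i.op) :=
  ConcreteCategory.congr_hom ((algebraSheafToMatrix σ).hom.naturality i.op) r

@[reducible] noncomputable def matrixModuleStructure {X : Sch k}
    (σ : A →ₐ[k] Matrix (Fin n) (Fin n) Γ(X.left, ⊤)) (U : X.left.Opens) :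
    Module ((algebraSheaf A X).obj.obj (op U)) (Fin n → Γ(X.left, U)) where
  smul r c := (toMatrix σ U r).mulVec c
  one_smul c := by
    change (toMatrix σ U 1).mulVec c = c
    rw [map_one, Matrix.one_mulVec]
  mul_smul r s c := by
    change (toMatrix σ U (r * s)).mulVec c = (toMatrix σ U r).mulVec ((toMatrix σ U s).mulVec c)
    rw [map_mul, Matrix.mulVec_mulVec]
  smul_zero r := Matrix.mulVec_zero _
  smul_add r c d := Matrix.mulVec_add _ c d
  add_smul r s c := by
    change (toMatrix σ U (r + s)).mulVec c = (toMatrix σ U r).mulVec c + (toMatrix σ U s).mulVec c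
    rw [map_add, Matrix.add_mulVec]
  zero_smul c := by
    change (toMatrix σ U 0).mulVec c = 0
    rw [map_zero, Matrix.zero_mulVec]

noncomputable def freePresheaf (n : ℕ) (X : Sch k) : (X.left.Opens)ᵒᵖ ⥤ Ab.{u} where
  obj U := AddCommGrpCat.of (Fin n → Γ(X.left, U.unop))
  map i := AddCommGrpCat.ofHom ((X.left.presheaf.map i).hom.toAddMonoidHom.compLeft (Fin n))
  map_id U := AddCommGrpCat.hom_ext (AddMonoidHom.ext fun c => funext fun j =>
    ConcreteCategory.congr_hom (X.left.presheaf.map_id U) (c j))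
  map_comp i i' := AddCommGrpCat.hom_ext (AddMonoidHom.ext fun c => funext fun j =>
    ConcreteCategory.congr_hom (X.left.presheaf.map_comp i i') (c j))

/-- The `A_X`-module `𝒪_X^n` on which `A` acts through the matrices `σ a`. -/
noncomputable def matrixModule {X : Sch k} (σ : A →ₐ[k] Matrix (Fin n) (Fin n) Γ(X.left, ⊤)) :
    AlgebraModules A X where
  val :=
    letI : ∀ U, Module ((algebraSheaf A X).obj.obj U) ((freePresheaf n X).obj U) :=
      fun U => matrixModuleStructure σ U.unop
    PresheafOfModules.ofPresheaf (freePresheaf n X) (fun U V i r m => by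
      change (X.left.presheaf.map i) ∘ ((toMatrix σ U.unop r).mulVec m) =
        (toMatrix σ V.unop _).mulVec ((X.left.presheaf.map i) ∘ m)
      have h := toMatrix_map σ i.unop r
      erw [h]
      funext j
      exact (X.left.presheaf.map i).hom.map_mulVec (toMatrix σ U.unop r) m j)
  isSheaf := by
    refine (Presheaf.isSheaf_iff_isSheaf_forget _ _ (forget AddCommGrpCat.{u})).2
      ((isSheaf_iff_isSheaf_of_type _ _).2 ?_)
    exact isSheaf_of_equiv_pi (ι := Fin n) (isSheaf_functions X)
      (fun U => Equiv.refl _) (fun i x j => rfl)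

theorem matrixModule_restrict {X : Sch k} (σ : A →ₐ[k] Matrix (Fin n) (Fin n) Γ(X.left, ⊤))
    {U V : X.left.Opens} (h : V ≤ U) (c : Fin n → Γ(X.left, U)) (i : Fin n) :
    (show Fin n → Γ(X.left, V) from restrict (matrixModule σ) h c) i =
      X.left.presheaf.map (homOfLE h).op (c i) := rfl

theorem matrixModule_smul {X : Sch k} (σ : A →ₐ[k] Matrix (Fin n) (Fin n) Γ(X.left, ⊤))
    (U : X.left.Opens) (r : (algebraSheaf A X).obj.obj (op U)) (c : Fin n → Γ(X.left, U)) :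
    (show Fin n → Γ(X.left, U) from r • (show (matrixModule σ).val.obj (op U) from c)) =
      (toMatrix σ U r).mulVec c := rfl
end

section
variable {k : Type u} [CommRing k] {A : Type u} [Ring A] [Algebra k A] {n : ℕ}

theorem commute_fromFunctions_fromAlgebra (X : Sch k) (U : X.left.Opens) (s : Γ(X.left, U))
    (a : A) : fromAlgebra A X U a * fromFunctions A X U s =
      fromFunctions A X U s * fromAlgebra A X U a := by
  refine Eq.trans ?_ (toAlgebraSheaf_tmul (A := A) X U s a)
  refine (map_mul ((toAlgebraSheaf A X).app (op U)).hom ((1 : Γ(X.left, U)) ⊗ₜ[k] a)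
    (s ⊗ₜ[k] (1 : A))).symm.trans ?_
  refine congrArg ((toAlgebraSheaf A X).app (op U)).hom ?_
  refine (Algebra.TensorProduct.tmul_mul_tmul 1 s a 1).trans ?_
  rw [mul_one, one_mul]

theorem fromFunctions_algebraMap (X : Sch k) (U : X.left.Opens) (r : k) :
    fromFunctions A X U (algebraMap k _ r) = fromAlgebra A X U (algebraMap k A r) := by
  refine congrArg ((toAlgebraSheaf A X).app (op U)).hom ?_
  change (algebraMap k Γ(X.left, U) r) ⊗ₜ[k] (1 : A) = (1 : Γ(X.left, U)) ⊗ₜ[k] algebraMap k A r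
  rw [Algebra.algebraMap_eq_smul_one, Algebra.algebraMap_eq_smul_one, TensorProduct.smul_tmul]

/-- The linear combination `∑ i, c i • B i` over `U`. -/
noncomputable def combination {X : Sch k} (M : AlgebraModules A X)
    (B : Fin n → M.val.obj (op ⊤)) (U : X.left.Opens) :
    (Fin n → Γ(X.left, U)) →+ M.val.obj (op U) where
  toFun c := ∑ i, fromFunctions A X U (c i) • restrict M (le_top : U ≤ ⊤) (B i)
  map_zero' := by simp
  map_add' c d := by simp [add_smul, Finset.sum_add_distrib]

theorem combination_apply {X : Sch k} (M : AlgebraModules A X)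
    (B : Fin n → M.val.obj (op ⊤)) (U : X.left.Opens) (c : Fin n → Γ(X.left, U)) :
    combination M B U c =
      ∑ i, fromFunctions A X U (c i) • restrict M (le_top : U ≤ ⊤) (B i) := rfl

theorem combination_single {X : Sch k} (M : AlgebraModules A X)
    (B : Fin n → M.val.obj (op ⊤)) (j : Fin n) :
    combination M B ⊤ (Pi.single j 1) = B j := by
  rw [combination_apply, Finset.sum_eq_single j]
  · rw [Pi.single_eq_same, map_one, one_smul]
    exact restrict_self M (B j)
  · intro i _ hij
    rw [Pi.single_eq_of_ne hij, map_zero, zero_smul]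
  · simp

theorem combination_smul {X : Sch k} (M : AlgebraModules A X)
    (B : Fin n → M.val.obj (op ⊤)) (U : X.left.Opens) (s : Γ(X.left, U))
    (c : Fin n → Γ(X.left, U)) :
    combination M B U (s • c) = fromFunctions A X U s • combination M B U c := by
  simp only [combination_apply, Pi.smul_apply, smul_eq_mul, map_mul, mul_smul, Finset.smul_sum]

theorem restrict_combination {X : Sch k} (M : AlgebraModules A X)
    (B : Fin n → M.val.obj (op ⊤)) {U V : X.left.Opens} (h : V ≤ U) (c : Fin n → Γ(X.left, U)) :
    restrict M h (combination M B U c) =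
      combination M B V (fun i => X.left.presheaf.map (homOfLE h).op (c i)) := by
  simp only [combination_apply, map_sum, restrict_fromFunctions_smul, restrict_restrict]

theorem fromAlgebra_smul_combination {X : Sch k} (M : AlgebraModules A X)
    (B : Fin n → M.val.obj (op ⊤)) (a : A) (S : Matrix (Fin n) (Fin n) Γ(X.left, ⊤))
    (hS : ∀ j, fromAlgebra A X ⊤ a • B j = combination M B ⊤ (fun i => S i j))
    (U : X.left.Opens) (c : Fin n → Γ(X.left, U)) :
    fromAlgebra A X U a • combination M B U c =
      combination M B U
        ((S.map (X.left.presheaf.map (homOfLE (le_top : U ≤ ⊤)).op)).mulVec c) := by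
  have h1 : ∀ j, fromAlgebra A X U a • restrict M (le_top : U ≤ ⊤) (B j) =
      combination M B U (fun i => X.left.presheaf.map (homOfLE (le_top : U ≤ ⊤)).op (S i j)) := by
    intro j
    rw [← restrict_fromAlgebra_smul, hS, restrict_combination]
  have h2 : (S.map (X.left.presheaf.map (homOfLE (le_top : U ≤ ⊤)).op)).mulVec c =
      ∑ j, c j • fun i => X.left.presheaf.map (homOfLE (le_top : U ≤ ⊤)).op (S i j) := by
    funext i
    simp [Matrix.mulVec, dotProduct, Finset.sum_apply, mul_comm]
  rw [h2, map_sum, combination_apply, Finset.smul_sum]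
  refine Finset.sum_congr rfl fun j _ => ?_
  rw [combination_smul, ← h1, ← mul_smul, commute_fromFunctions_fromAlgebra, mul_smul]

theorem hom_combination {X : Sch k} {M N : AlgebraModules A X} (g : M ⟶ N)
    (B : Fin n → M.val.obj (op ⊤)) (U : X.left.Opens) (c : Fin n → Γ(X.left, U)) :
    (g.val.app (op U)).hom (combination M B U c) =
      combination N (fun i => (g.val.app (op ⊤)).hom (B i)) U c := by
  simp only [combination_apply, map_sum, map_smul, hom_restrict]

theorem combination_pushforward {X Y : Sch k} (f : Y ⟶ X) (N : AlgebraModules A Y)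
    (B : Fin n → N.val.obj (op ⊤)) (U : X.left.Opens) (c : Fin n → Γ(X.left, U)) :
    combination (pushforwardModule f N) B U c =
      combination N B (f.left ⁻¹ᵁ U) (fun i => f.left.app U (c i)) := by
  refine (combination_apply (pushforwardModule f N) B U c).trans
    (Eq.trans ?_ (combination_apply N B (f.left ⁻¹ᵁ U) _).symm)
  exact Finset.sum_congr rfl fun i _ => pushforwardModule_fromFunctions_smul f N U (c i)
    (restrict N (le_top : f.left ⁻¹ᵁ U ≤ ⊤) (B i))

theorem matrixModule_fromFunctions_smul {X : Sch k}
    (σ : A →ₐ[k] Matrix (Fin n) (Fin n) Γ(X.left, ⊤)) (U : X.left.Opens) (s : Γ(X.left, U))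
    (c : Fin n → Γ(X.left, U)) :
    (show Fin n → Γ(X.left, U) from
      fromFunctions A X U s • (show (matrixModule σ).val.obj (op U) from c)) = s • c := by
  refine (matrixModule_smul σ U _ c).trans ?_
  rw [toMatrix_fromFunctions, Matrix.smul_mulVec, Matrix.one_mulVec]

noncomputable def matrixModuleHom {X : Sch k}
    (σ : A →ₐ[k] Matrix (Fin n) (Fin n) Γ(X.left, ⊤)) (N : AlgebraModules A X)
    (B : Fin n → N.val.obj (op ⊤))
    (hB : ∀ a j, fromAlgebra A X ⊤ a • B j = combination N B ⊤ (fun i => σ a i j)) :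
    matrixModule σ ⟶ N :=
  mkHom (matrixModule σ) N (fun U => combination N B U)
    (fun U V h c => (restrict_combination N B h c).symm)
    (fun U s c => by
      refine Eq.trans ?_ (combination_smul N B U s c)
      exact congrArg (combination N B U) (matrixModule_fromFunctions_smul σ U s c))
    (fun U a c => by
      refine Eq.trans ?_ (fromAlgebra_smul_combination N B a (σ a) (hB a) U c).symm
      refine congrArg (combination N B U) ?_
      refine (matrixModule_smul σ U _ c).trans ?_
      rw [toMatrix_fromAlgebra])

theorem matrixModuleHom_app {X : Sch k}
    (σ : A →ₐ[k] Matrix (Fin n) (Fin n) Γ(X.left, ⊤)) (N : AlgebraModules A X)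
    (B : Fin n → N.val.obj (op ⊤)) (hB) (U : X.left.Opens) (c : Fin n → Γ(X.left, U)) :
    ((matrixModuleHom σ N B hB).val.app (op U)).hom c = combination N B U c := rfl

noncomputable def standardBasis {X : Sch k} (σ : A →ₐ[k] Matrix (Fin n) (Fin n) Γ(X.left, ⊤)) :
    Fin n → (matrixModule σ).val.obj (op ⊤) :=
  fun j => (Pi.single j 1 : Fin n → Γ(X.left, ⊤))

theorem combination_standardBasis {X : Sch k}
    (σ : A →ₐ[k] Matrix (Fin n) (Fin n) Γ(X.left, ⊤)) (U : X.left.Opens)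
    (c : Fin n → Γ(X.left, U)) :
    combination (matrixModule σ) (standardBasis σ) U c = c := by
  have h : ∀ j, fromFunctions A X U (c j) • restrict (matrixModule σ) (le_top : U ≤ ⊤)
      (standardBasis σ j) = (Pi.single j (c j) : Fin n → Γ(X.left, U)) := by
    intro j
    refine (matrixModule_fromFunctions_smul σ U _ _).trans ?_
    funext i
    refine (congrArg (c j * ·) (matrixModule_restrict σ le_top _ i)).trans ?_
    refine (congrArg (fun z => c j * X.left.presheaf.map (homOfLE (le_top : U ≤ ⊤)).op z)
      (Pi.single_apply j (1 : Γ(X.left, ⊤)) i)).trans ?_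
    rw [Pi.single_apply]
    split_ifs
    · simp
    · simp
  rw [combination_apply]
  simp only [h]
  exact Finset.univ_sum_single c

theorem Triple.bijective {X : Sch k} (T : Triple A n X) (U : X.left.Opens) :
    Function.Bijective (combination T.M T.B U) := T.basis U

/-- Coordinates in the basis of a triple. -/
noncomputable def Triple.coord {X : Sch k} (T : Triple A n X) (U : X.left.Opens) :
    T.M.val.obj (op U) ≃+ (Fin n → Γ(X.left, U)) :=
  (AddEquiv.ofBijective (combination T.M T.B U) (T.bijective U)).symm

theorem Triple.combination_coord {X : Sch k} (T : Triple A n X) (U : X.left.Opens)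
    (m : T.M.val.obj (op U)) : combination T.M T.B U (T.coord U m) = m :=
  (AddEquiv.ofBijective (combination T.M T.B U) (T.bijective U)).apply_symm_apply m

theorem Triple.coord_combination {X : Sch k} (T : Triple A n X) (U : X.left.Opens)
    (c : Fin n → Γ(X.left, U)) : T.coord U (combination T.M T.B U c) = c :=
  (AddEquiv.ofBijective (combination T.M T.B U) (T.bijective U)).symm_apply_apply c

theorem Triple.coord_basis {X : Sch k} (T : Triple A n X) (j : Fin n) :
    T.coord ⊤ (T.B j) = Pi.single j 1 := by
  rw [← T.coord_combination ⊤ (Pi.single j 1), combination_single]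

theorem Triple.coord_restrict {X : Sch k} (T : Triple A n X) {U V : X.left.Opens} (h : V ≤ U)
    (m : T.M.val.obj (op U)) : T.coord V (restrict T.M h m) =
      fun i => X.left.presheaf.map (homOfLE h).op (T.coord U m i) := by
  conv_lhs => rw [← T.combination_coord U m, restrict_combination, T.coord_combination]

theorem Triple.coord_fromFunctions_smul {X : Sch k} (T : Triple A n X) (U : X.left.Opens)
    (s : Γ(X.left, U)) (m : T.M.val.obj (op U)) :
    T.coord U (fromFunctions A X U s • m) = s • T.coord U m := by
  conv_lhs => rw [← T.combination_coord U m, ← combination_smul, T.coord_combination]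

noncomputable def Triple.matrix {X : Sch k} (T : Triple A n X) (a : A) :
    Matrix (Fin n) (Fin n) Γ(X.left, ⊤) :=
  Matrix.of fun i j => T.coord ⊤ (fromAlgebra A X ⊤ a • T.B j) i

theorem Triple.fromAlgebra_smul_basis {X : Sch k} (T : Triple A n X) (a : A) (j : Fin n) :
    fromAlgebra A X ⊤ a • T.B j = combination T.M T.B ⊤ (fun i => T.matrix a i j) :=
  (T.combination_coord ⊤ _).symm

theorem Triple.coord_fromAlgebra_smul {X : Sch k} (T : Triple A n X) (U : X.left.Opens)
    (a : A) (m : T.M.val.obj (op U)) :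
    T.coord U (fromAlgebra A X U a • m) =
      ((T.matrix a).map (X.left.presheaf.map (homOfLE (le_top : U ≤ ⊤)).op)).mulVec
        (T.coord U m) := by
  conv_lhs => rw [← T.combination_coord U m,
    fromAlgebra_smul_combination T.M T.B a (T.matrix a) (T.fromAlgebra_smul_basis a),
    T.coord_combination]

theorem Triple.coord_top_fromAlgebra_smul {X : Sch k} (T : Triple A n X)
    (a : A) (m : T.M.val.obj (op ⊤)) :
    T.coord ⊤ (fromAlgebra A X ⊤ a • m) = (T.matrix a).mulVec (T.coord ⊤ m) := by
  rw [T.coord_fromAlgebra_smul]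
  congr 1
  ext i j
  exact ConcreteCategory.congr_hom (X.left.presheaf.map_id (op ⊤)) (T.matrix a i j)

theorem Triple.matrix_one {X : Sch k} (T : Triple A n X) : T.matrix (1 : A) = 1 := by
  ext i j
  simp [Triple.matrix, T.coord_basis, Matrix.one_apply, Pi.single_apply]

theorem Triple.matrix_mul {X : Sch k} (T : Triple A n X) (a b : A) :
    T.matrix (a * b) = T.matrix a * T.matrix b := by
  ext i j
  change T.coord ⊤ (fromAlgebra A X ⊤ (a * b) • T.B j) i = _
  rw [map_mul, mul_smul, T.coord_top_fromAlgebra_smul]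
  rfl

theorem Triple.matrix_add {X : Sch k} (T : Triple A n X) (a b : A) :
    T.matrix (a + b) = T.matrix a + T.matrix b := by
  ext i j
  change T.coord ⊤ (fromAlgebra A X ⊤ (a + b) • T.B j) i = _
  rw [map_add, add_smul, map_add]
  rfl

theorem Triple.matrix_zero {X : Sch k} (T : Triple A n X) : T.matrix (0 : A) = 0 := by
  ext i j
  change T.coord ⊤ (fromAlgebra A X ⊤ 0 • T.B j) i = _
  rw [map_zero, zero_smul, map_zero]
  rfl

theorem Triple.matrix_algebraMap {X : Sch k} (T : Triple A n X) (r : k) :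
    T.matrix (algebraMap k A r) =
      algebraMap k (Matrix (Fin n) (Fin n) Γ(X.left, ⊤)) r := by
  ext i j
  change T.coord ⊤ (fromAlgebra A X ⊤ (algebraMap k A r) • T.B j) i = _
  rw [← fromFunctions_algebraMap, T.coord_fromFunctions_smul, T.coord_basis]
  rw [Matrix.algebraMap_matrix_apply, Pi.smul_apply, Pi.single_apply, smul_eq_mul, mul_ite,
    mul_one, mul_zero]

/-- The matrices by which `A` acts on the basis of a triple. -/
noncomputable def Triple.matrixHom {X : Sch k} (T : Triple A n X) :
    A →ₐ[k] Matrix (Fin n) (Fin n) Γ(X.left, ⊤) where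
  toFun := T.matrix
  map_one' := T.matrix_one
  map_mul' := T.matrix_mul
  map_zero' := T.matrix_zero
  map_add' := T.matrix_add
  commutes' := T.matrix_algebraMap

end

section
variable {k : Type u} [CommRing k] {A : Type u} [Ring A] [Algebra k A] {n : ℕ}

noncomputable def Triple.pullbackMatrixHom {X Y : Sch k} (f : Y ⟶ X) (T : Triple A n X) :
    A →ₐ[k] Matrix (Fin n) (Fin n) Γ(Y.left, ⊤) :=
  (AlgHom.mapMatrix (pullbackSections f ⊤)).comp T.matrixHom

noncomputable def Triple.toPushforward {X Y : Sch k} (f : Y ⟶ X) (T : Triple A n X) :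
    T.M ⟶ pushforwardModule f (matrixModule (T.pullbackMatrixHom f)) :=
  mkHom T.M _
    (fun U => ((f.left.app U).hom.toAddMonoidHom.compLeft (Fin n)).comp
      (T.coord U).toAddMonoidHom)
    (fun U V h m => by
      funext i
      refine (congrArg (fun c : Fin n → Γ(X.left, V) => f.left.app V (c i))
        (T.coord_restrict h m)).trans ?_
      exact ConcreteCategory.congr_hom (f.left.naturality (homOfLE h).op) (T.coord U m i))
    (fun U s m => by
      refine Eq.trans ?_ ((pushforwardModule_fromFunctions_smul f
        (matrixModule (T.pullbackMatrixHom f)) U s _).trans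
        (matrixModule_fromFunctions_smul _ (f.left ⁻¹ᵁ U) _ _)).symm
      funext i
      refine (congrArg (fun c : Fin n → Γ(X.left, U) => f.left.app U (c i))
        (T.coord_fromFunctions_smul U s m)).trans ?_
      exact map_mul (f.left.app U).hom s _)
    (fun U a m => by
      refine Eq.trans ?_ ((pushforwardModule_fromAlgebra_smul f
        (matrixModule (T.pullbackMatrixHom f)) U a _).trans
        (matrixModule_smul _ (f.left ⁻¹ᵁ U) _ _)).symm
      rw [toMatrix_fromAlgebra]
      funext i
      refine (congrArg (fun c : Fin n → Γ(X.left, U) => f.left.app U (c i))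
        (T.coord_fromAlgebra_smul U a m)).trans ?_
      refine ((f.left.app U).hom.map_mulVec _ _ i).trans ?_
      refine congrArg (fun S : Matrix (Fin n) (Fin n) Γ(Y.left, f.left ⁻¹ᵁ U) => S.mulVec _ i) ?_
      ext p q
      exact ConcreteCategory.congr_hom
        (f.left.naturality (homOfLE (le_top : U ≤ ⊤)).op) (T.matrix a p q))

theorem Triple.toPushforward_app {X Y : Sch k} (f : Y ⟶ X) (T : Triple A n X)
    (U : X.left.Opens) (m : T.M.val.obj (op U)) :
    ((T.toPushforward f).val.app (op U)).hom m =
      fun i => f.left.app U (T.coord U m i) := rfl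

noncomputable def toPushforwardPullback {X Y : Sch k} (f : Y ⟶ X) (M : AlgebraModules A X) :
    M ⟶ pushforwardModule f (pullbackModule f M) :=
  (SheafOfModules.pullbackPushforwardAdjunction.{u} (algebraSheafMap A f)).unit.app M

noncomputable def pullbackDesc {X Y : Sch k} (f : Y ⟶ X) {M : AlgebraModules A X}
    {N : AlgebraModules A Y} (g : M ⟶ pushforwardModule f N) : pullbackModule f M ⟶ N :=
  ((SheafOfModules.pullbackPushforwardAdjunction.{u} (algebraSheafMap A f)).homEquiv _ _).symm g

theorem pullbackDesc_pullbackSection {X Y : Sch k} (f : Y ⟶ X) {M : AlgebraModules A X}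
    {N : AlgebraModules A Y} (g : M ⟶ pushforwardModule f N) (U : X.left.Opens)
    (m : M.val.obj (op U)) :
    ((pullbackDesc f g).val.app (op (f.left ⁻¹ᵁ U))).hom (pullbackSection f M m) =
      (g.val.app (op U)).hom m := by
  have h := ((SheafOfModules.pullbackPushforwardAdjunction.{u}
    (algebraSheafMap A f)).homEquiv_apply _ _ (pullbackDesc f g))
  rw [pullbackDesc, Equiv.apply_symm_apply] at h
  exact congrArg (fun z : M ⟶ pushforwardModule f N => (z.val.app (op U)).hom m) h.symm

theorem pullback_hom_ext {X Y : Sch k} (f : Y ⟶ X) {M : AlgebraModules A X}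
    {N : AlgebraModules A Y} (g g' : pullbackModule f M ⟶ N)
    (h : ∀ (U : X.left.Opens) (m : M.val.obj (op U)),
      (g.val.app (op (f.left ⁻¹ᵁ U))).hom (pullbackSection f M m) =
        (g'.val.app (op (f.left ⁻¹ᵁ U))).hom (pullbackSection f M m)) : g = g' := by
  apply ((SheafOfModules.pullbackPushforwardAdjunction.{u}
    (algebraSheafMap A f)).homEquiv _ _).injective
  rw [Adjunction.homEquiv_apply, Adjunction.homEquiv_apply]
  apply SheafOfModules.hom_ext
  apply PresheafOfModules.hom_ext
  intro U
  ext m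
  exact h U.unop m

theorem Triple.pullbackSection_eq {X Y : Sch k} (f : Y ⟶ X) (T : Triple A n X)
    (U : X.left.Opens) (m : T.M.val.obj (op U)) :
    pullbackSection f T.M m =
      combination (pullbackModule f T.M) (fun i => pullbackSection f T.M (T.B i)) (f.left ⁻¹ᵁ U)
        (fun i => f.left.app U (T.coord U m i)) := by
  conv_lhs => rw [← T.combination_coord U m]
  refine (hom_combination (toPushforwardPullback f T.M) T.B U _).trans ?_
  exact combination_pushforward f (pullbackModule f T.M) _ U _

theorem pullbackSection_fromAlgebra_smul {X Y : Sch k} (f : Y ⟶ X) (M : AlgebraModules A X)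
    (U : X.left.Opens) (a : A) (m : M.val.obj (op U)) :
    pullbackSection f M (fromAlgebra A X U a • m) =
      fromAlgebra A Y (f.left ⁻¹ᵁ U) a • pullbackSection f M m := by
  refine (map_smul ((toPushforwardPullback f M).val.app (op U)).hom _ m).trans ?_
  exact pushforwardModule_fromAlgebra_smul f (pullbackModule f M) U a _

theorem pullbackSection_smul {X Y : Sch k} (f : Y ⟶ X) (M : AlgebraModules A X)
    (U : X.left.Opens) (r : (algebraSheaf A X).obj.obj (op U)) (m : M.val.obj (op U)) :
    pullbackSection f M (r • m) =
      (show (algebraSheaf A Y).obj.obj (op (f.left ⁻¹ᵁ U)) from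
        (algebraSheafMap A f).hom.app (op U) r) • pullbackSection f M m :=
  map_smul ((toPushforwardPullback f M).val.app (op U)).hom r m

theorem pullbackSection_restrict {X Y : Sch k} (f : Y ⟶ X) (M : AlgebraModules A X)
    {U V : X.left.Opens} (h : V ≤ U) (m : M.val.obj (op U)) :
    pullbackSection f M (restrict M h m) =
      restrict (pullbackModule f M) (show f.left ⁻¹ᵁ V ≤ f.left ⁻¹ᵁ U from fun _ hy => h hy)
        (pullbackSection f M m) :=
  hom_restrict (toPushforwardPullback f M) h m

theorem Triple.pullback_basis {X Y : Sch k} (f : Y ⟶ X) (T : Triple A n X) (U : Y.left.Opens) :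
    Function.Bijective (combination (pullbackModule f T.M)
      (fun i => pullbackSection f T.M (T.B i)) U) := by
  let B' : Fin n → (pullbackModule f T.M).val.obj (op ⊤) := fun i => pullbackSection f T.M (T.B i)
  let σ := T.pullbackMatrixHom f
  let θ : pullbackModule f T.M ⟶ matrixModule σ := pullbackDesc f (T.toPushforward f)
  have hB' : ∀ a j, fromAlgebra A Y ⊤ a • B' j =
      combination (pullbackModule f T.M) B' ⊤ (fun i => σ a i j) := by
    intro a j
    refine (pullbackSection_fromAlgebra_smul f T.M ⊤ a (T.B j)).symm.trans ?_
    exact T.pullbackSection_eq f ⊤ _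
  let ψ : matrixModule σ ⟶ pullbackModule f T.M := matrixModuleHom σ (pullbackModule f T.M) B' hB'
  have hθ : ∀ i, (θ.val.app (op ⊤)).hom (B' i) = standardBasis σ i := by
    intro i
    refine (pullbackDesc_pullbackSection f (T.toPushforward f) ⊤ (T.B i)).trans ?_
    refine (T.toPushforward_app f ⊤ (T.B i)).trans ?_
    rw [T.coord_basis]
    funext j
    refine (congrArg (f.left.app ⊤).hom (Pi.single_apply i (1 : Γ(X.left, ⊤)) j)).trans ?_
    refine Eq.trans ?_ (Pi.single_apply i (1 : Γ(Y.left, ⊤)) j).symm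
    split_ifs
    · exact map_one (f.left.app ⊤).hom
    · exact map_zero (f.left.app ⊤).hom
  have h1 : ∀ c : Fin n → Γ(Y.left, U),
      (θ.val.app (op U)).hom (combination (pullbackModule f T.M) B' U c) = c := by
    intro c
    refine (hom_combination θ B' U c).trans ?_
    rw [funext hθ]
    exact combination_standardBasis σ U c
  have h2 : θ ≫ ψ = 𝟙 _ := by
    apply pullback_hom_ext
    intro V m
    have e1 := pullbackDesc_pullbackSection f (T.toPushforward f) V m
    refine (congrArg (ψ.val.app (op (f.left ⁻¹ᵁ V))).hom e1).trans ?_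
    exact (T.pullbackSection_eq f V m).symm
  refine ⟨fun c d h => ?_, fun m => ⟨(θ.val.app (op U)).hom m, ?_⟩⟩
  · rw [← h1 c, ← h1 d]
    exact congrArg (θ.val.app (op U)).hom h
  · exact congrArg (fun z : pullbackModule f T.M ⟶ pullbackModule f T.M =>
      (z.val.app (op U)).hom m) h2

/-- The pullback `(f^* M, f^* v, f^* B)` of a triple. -/
noncomputable def Triple.pullback {X Y : Sch k} (f : Y ⟶ X) (T : Triple A n X) : Triple A n Y where
  M := pullbackModule f T.M
  v := pullbackSection f T.M T.v
  B i := pullbackSection f T.M (T.B i)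
  basis := T.pullback_basis f
  generates U m y hy := by
    obtain ⟨c, rfl⟩ := (T.pullback_basis f U).2 m
    have hloc : ∀ i, ∃ (V : X.left.Opens) (r : (algebraSheaf A X).obj.obj (op V)),
        f.left y ∈ V ∧ r • restrict T.M (le_top : V ≤ ⊤) T.v =
          restrict T.M (le_top : V ≤ ⊤) (T.B i) := by
      intro i
      obtain ⟨V, h, r, hr⟩ := T.generates ⊤ (T.B i) (f.left y) trivial
      exact ⟨V, r, hr⟩
    choose V r hV hr using hloc
    let W : Y.left.Opens := ⟨(U : Set Y.left) ∩ ⋂ i, (f.left ⁻¹ᵁ (V i) : Set Y.left),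
      U.isOpen.inter (isOpen_iInter_of_finite fun i => (f.left ⁻¹ᵁ (V i)).isOpen)⟩
    have hWU : W ≤ U := fun z hz => hz.1
    have hWV : ∀ i, W ≤ f.left ⁻¹ᵁ (V i) := fun i z hz => Set.mem_iInter.1 hz.2 i
    have hyW : y ∈ W := ⟨hy, Set.mem_iInter.2 hV⟩
    let a : Fin n → (algebraSheaf A Y).obj.obj (op W) := fun i =>
      (algebraSheaf A Y).obj.map (homOfLE (hWV i)).op
        (show (algebraSheaf A Y).obj.obj (op (f.left ⁻¹ᵁ (V i))) from
          (algebraSheafMap A f).hom.app (op (V i)) (r i))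
    have ha : ∀ i, a i • restrict (pullbackModule f T.M) (le_top : W ≤ ⊤)
        (pullbackSection f T.M T.v) =
          restrict (pullbackModule f T.M) (le_top : W ≤ ⊤) (pullbackSection f T.M (T.B i)) := by
      intro i
      have e := congrArg (restrict (pullbackModule f T.M) (hWV i))
        (congrArg (pullbackSection f T.M) (hr i))
      rw [pullbackSection_smul, restrict_smul, pullbackSection_restrict,
        pullbackSection_restrict] at e
      erw [restrict_restrict, restrict_restrict] at e
      exact e
    refine ⟨W, hWU, ∑ i, fromFunctions A Y W (Y.left.presheaf.map (homOfLE hWU).op (c i)) * a i,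
      hyW, ?_⟩
    refine Eq.trans ?_ (restrict_combination (pullbackModule f T.M)
      (fun i => pullbackSection f T.M (T.B i)) hWU c).symm
    refine (Finset.sum_smul (f := fun i => fromFunctions A Y W
      (Y.left.presheaf.map (homOfLE hWU).op (c i)) * a i)).trans ?_
    refine Finset.sum_congr rfl fun i _ => ?_
    rw [mul_smul]
    exact congrArg _ (ha i)

/-- Two triples are equivalent if there is an isomorphism of `A_X`-modules that carries the
generator to the generator and the basis to the basis. -/
def Triple.IsEquivalent {X : Sch k} (T T' : Triple A n X) : Prop :=
  ∃ e : T.M ≅ T'.M, (e.hom.val.app (op ⊤)).hom T.v = T'.v ∧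
    ∀ i, (e.hom.val.app (op ⊤)).hom (T.B i) = T'.B i

end

section
variable {k : Type u} [CommRing k] {A : Type u} [Ring A] [Algebra k A] {n : ℕ}

variable (A n) in
/-- Equivalence of triples, as a setoid. -/
def tripleSetoid (X : Sch k) : Setoid (Triple A n X) where
  r := Triple.IsEquivalent
  iseqv :=
    { refl := fun T => ⟨Iso.refl _, rfl, fun _ => rfl⟩
      symm := by
        rintro T T' ⟨e, hv, hB⟩
        have h : ∀ m : T.M.val.obj (op ⊤), (e.inv.val.app (op ⊤)).hom
            ((e.hom.val.app (op ⊤)).hom m) = m := fun m =>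
          congrArg (fun z : T.M ⟶ T.M => (z.val.app (op ⊤)).hom m) e.hom_inv_id
        exact ⟨e.symm, by rw [← hv]; exact h _, fun i => by rw [← hB]; exact h _⟩
      trans := by
        rintro T T' T'' ⟨e, hv, hB⟩ ⟨e', hv', hB'⟩
        exact ⟨e ≪≫ e', by rw [← hv', ← hv]; rfl, fun i => by rw [← hB', ← hB]; rfl⟩ }

theorem Triple.isEquivalent_of_hom {X : Sch k} {T T' : Triple A n X} (g : T.M ⟶ T'.M)
    (hv : (g.val.app (op ⊤)).hom T.v = T'.v)
    (hB : ∀ i, (g.val.app (op ⊤)).hom (T.B i) = T'.B i) : T.IsEquivalent T' := by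
  have key : ∀ U : X.left.Opens, Function.Bijective (g.val.app (op U)).hom := by
    intro U
    have h : ∀ c, (g.val.app (op U)).hom (combination T.M T.B U c) =
        combination T'.M T'.B U c := by
      intro c
      rw [hom_combination, funext hB]
    have h' : (g.val.app (op U)).hom ∘ (combination T.M T.B U) = combination T'.M T'.B U :=
      funext h
    exact (Function.Bijective.of_comp_iff _ (T.bijective U)).1 (h' ▸ T'.bijective U)
  let e : T.M.val ≅ T'.M.val := PresheafOfModules.isoMk
    (fun U => (LinearEquiv.ofBijective (g.val.app U).hom (key U.unop)).toModuleIso)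
    (fun _ _ i => g.val.naturality i)
  exact ⟨(SheafOfModules.fullyFaithfulForget _).preimageIso e, hv, hB⟩

/-- There is a map `M → f_* M'` of `A_X`-modules that carries `v` to `v'` and `B` to `B'`. -/
def Triple.IsOver {X Y : Sch k} (f : Y ⟶ X) (T : Triple A n X) (T' : Triple A n Y) : Prop :=
  ∃ g : T.M ⟶ pushforwardModule f T'.M, (g.val.app (op ⊤)).hom T.v = T'.v ∧
    ∀ i, (g.val.app (op ⊤)).hom (T.B i) = T'.B i

theorem Triple.isOver_pullback {X Y : Sch k} (f : Y ⟶ X) (T : Triple A n X) :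
    T.IsOver f (T.pullback f) :=
  ⟨toPushforwardPullback f T.M, rfl, fun _ => rfl⟩

theorem Triple.IsOver.isEquivalent {X Y : Sch k} {f : Y ⟶ X} {T : Triple A n X}
    {T' : Triple A n Y} (h : T.IsOver f T') : (T.pullback f).IsEquivalent T' := by
  obtain ⟨g, hv, hB⟩ := h
  refine Triple.isEquivalent_of_hom (pullbackDesc f g) ?_ fun i => ?_
  · exact (pullbackDesc_pullbackSection f g ⊤ T.v).trans hv
  · exact (pullbackDesc_pullbackSection f g ⊤ (T.B i)).trans (hB i)

theorem Triple.isOver_id {X : Sch k} (T : Triple A n X) : T.IsOver (𝟙 X) T :=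
  ⟨mkHom T.M (pushforwardModule (𝟙 X) T.M) (fun _ => AddMonoidHom.id _)
    (fun _ _ _ _ => rfl)
    (fun U s m => (pushforwardModule_fromFunctions_smul (𝟙 X) T.M U s m).symm)
    (fun U a m => (pushforwardModule_fromAlgebra_smul (𝟙 X) T.M U a m).symm), rfl, fun _ => rfl⟩

theorem Triple.IsOver.comp {X Y Z : Sch k} {f : Y ⟶ X} {g : Z ⟶ Y} {T : Triple A n X}
    {T' : Triple A n Y} {T'' : Triple A n Z} (h : T.IsOver f T') (h' : T'.IsOver g T'') :
    T.IsOver (g ≫ f) T'' := by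
  obtain ⟨p, hv, hB⟩ := h
  obtain ⟨q, hv', hB'⟩ := h'
  refine ⟨mkHom T.M (pushforwardModule (g ≫ f) T''.M)
    (fun U => AddMonoidHom.comp (N := T'.M.val.obj (op (f.left ⁻¹ᵁ U)))
      (q.val.app (op (f.left ⁻¹ᵁ U))).hom.toAddMonoidHom
      (p.val.app (op U)).hom.toAddMonoidHom) ?_ ?_ ?_, ?_, ?_⟩
  · intro U V i m
    refine (congrArg (q.val.app (op (f.left ⁻¹ᵁ V))).hom (hom_restrict p i m)).trans ?_
    exact hom_restrict q (show f.left ⁻¹ᵁ V ≤ f.left ⁻¹ᵁ U from fun _ hy => i hy) _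
  · intro U s m
    refine (congrArg (q.val.app (op (f.left ⁻¹ᵁ U))).hom
      ((map_smul (p.val.app (op U)).hom _ m).trans
        (pushforwardModule_fromFunctions_smul f T'.M U s _))).trans ?_
    refine (map_smul (q.val.app (op (f.left ⁻¹ᵁ U))).hom _ _).trans ?_
    refine (pushforwardModule_fromFunctions_smul g T''.M (f.left ⁻¹ᵁ U) _ _).trans ?_
    refine Eq.trans ?_ (pushforwardModule_fromFunctions_smul (g ≫ f) T''.M U s _).symm
    have e : (g ≫ f).left.app U s = g.left.app (f.left ⁻¹ᵁ U) (f.left.app U s) := by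
      simp
      rfl
    rw [e]
    rfl
  · intro U a m
    refine (congrArg (q.val.app (op (f.left ⁻¹ᵁ U))).hom
      ((map_smul (p.val.app (op U)).hom _ m).trans
        (pushforwardModule_fromAlgebra_smul f T'.M U a _))).trans ?_
    refine (map_smul (q.val.app (op (f.left ⁻¹ᵁ U))).hom _ _).trans ?_
    refine (pushforwardModule_fromAlgebra_smul g T''.M (f.left ⁻¹ᵁ U) _ _).trans ?_
    exact (pushforwardModule_fromAlgebra_smul (g ≫ f) T''.M U a _).symm
  · exact (congrArg (q.val.app (op ⊤)).hom hv).trans hv'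
  · exact fun i => (congrArg (q.val.app (op ⊤)).hom (hB i)).trans (hB' i)

theorem Triple.IsOver.of_isEquivalent {X Y : Sch k} {f : Y ⟶ X} {T₁ T₂ : Triple A n X}
    {T' : Triple A n Y} (e : T₁.IsEquivalent T₂) (h : T₂.IsOver f T') : T₁.IsOver f T' := by
  obtain ⟨e, hv, hB⟩ := e
  obtain ⟨g, hv', hB'⟩ := h
  exact ⟨e.hom ≫ g, (congrArg (g.val.app (op ⊤)).hom hv).trans hv',
    fun i => (congrArg (g.val.app (op ⊤)).hom (hB i)).trans (hB' i)⟩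

variable (k A n) in
/-- The contravariant functor from `k`-schemes to sets that sends `X` to the set of equivalence
classes of triples `(M, v, B)` over `X`, and `f : Y ⟶ X` to the pullback of triples. -/
noncomputable def basedHilbertFunctor : (Sch k)ᵒᵖ ⥤ Type (u + 1) where
  obj X := Quotient (tripleSetoid A n X.unop)
  map f := ↾(Quotient.map (Triple.pullback f.unop) fun _ T₂ h =>
    (Triple.IsOver.of_isEquivalent h (T₂.isOver_pullback f.unop)).isEquivalent)
  map_id X := by
    ext x
    induction x using Quotient.inductionOn with
    | h T => exact Quotient.sound T.isOver_id.isEquivalent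
  map_comp f g := by
    ext x
    induction x using Quotient.inductionOn with
    | h T =>
      exact Quotient.sound ((T.isOver_pullback f.unop).comp
        ((T.pullback f.unop).isOver_pullback g.unop)).isEquivalent

theorem basedHilbertFunctor_map_eq_iff {X Y : Sch k} (f : Y ⟶ X) (T : Triple A n X)
    (T' : Triple A n Y) :
    (basedHilbertFunctor k A n).map f.op (Quotient.mk (tripleSetoid A n X) T) =
      Quotient.mk (tripleSetoid A n Y) T' ↔ T.IsOver f T' := by
  refine ⟨fun h => ?_, fun h => Quotient.sound h.isEquivalent⟩
  obtain ⟨e, hv, hB⟩ : (T.pullback f).IsEquivalent T' := Quotient.exact h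
  let g : pushforwardModule f (T.pullback f).M ⟶ pushforwardModule f T'.M :=
    (SheafOfModules.pushforward (algebraSheafMap A f)).map e.hom
  exact ⟨toPushforwardPullback f T.M ≫ g, hv, hB⟩
end

section
variable {k : Type u} [CommRing k] {A : Type u} [Ring A] [Algebra k A] {m : ℕ}

/-- The generic `n × n` matrix `A_s = (t^s_{ij})` over `k[t^s_{ij}]`. -/
noncomputable def genericMatrix (k : Type u) [CommRing k] (m n : ℕ) (s : Fin m) :
    Matrix (Fin n) (Fin n) (MvPolynomial (Fin m × Fin n × Fin n) k) :=
  Matrix.of fun i j => MvPolynomial.X (s, i, j)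

/-- The ideal of `k[t^s_{ij}]` generated by the entries of `r(A_1, …, A_m)`, for all relations `r`
between the generators `π x_1, …, π x_m` of `A`. -/
noncomputable def repIdeal (π : FreeAlgebra k (Fin m) →ₐ[k] A) (n : ℕ) :
    Ideal (MvPolynomial (Fin m × Fin n × Fin n) k) :=
  Ideal.span {p | ∃ r, π r = 0 ∧ ∃ i j, p = FreeAlgebra.lift k (genericMatrix k m n) r i j}

/-- The coordinate ring of the representation scheme `Rep`, the closed subscheme of
`Spec k[t^s_{ij}]` of all `m`-tuples of matrices that satisfy the relations of `A`. -/
abbrev RepRing (π : FreeAlgebra k (Fin m) →ₐ[k] A) (n : ℕ) : Type u :=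
  MvPolynomial (Fin m × Fin n × Fin n) k ⧸ repIdeal π n

/-- The coordinate ring of `Rep × 𝔸^n`: polynomials in `y_1, …, y_n` over `RepRing`. -/
abbrev RepVecRing (π : FreeAlgebra k (Fin m) →ₐ[k] A) (n : ℕ) : Type u :=
  MvPolynomial (Fin n) (RepRing π n)

/-- The matrix `A_s` over `Rep × 𝔸^n`. -/
noncomputable def universalMatrix (π : FreeAlgebra k (Fin m) →ₐ[k] A) (n : ℕ) (s : Fin m) :
    Matrix (Fin n) (Fin n) (RepVecRing π n) :=
  (genericMatrix k m n s).map fun p => MvPolynomial.C (Ideal.Quotient.mk (repIdeal π n) p)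

/-- The column vector `Y = (y_1, …, y_n)` over `Rep × 𝔸^n`. -/
noncomputable def universalVector (π : FreeAlgebra k (Fin m) →ₐ[k] A) (n : ℕ) :
    Fin n → RepVecRing π n :=
  MvPolynomial.X

/-- The determinant `D_f = det (Y, f_1(A_1, …, A_m) Y, …, f_{n-1}(A_1, …, A_m) Y)`. -/
noncomputable def cyclicDet (π : FreeAlgebra k (Fin m) →ₐ[k] A) (n : ℕ)
    (f : Fin (n - 1) → FreeAlgebra k (Fin m)) : RepVecRing π n :=
  Matrix.det (Matrix.of fun i j : Fin n =>
    if h : (j : ℕ) = 0 then universalVector π n i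
    else (FreeAlgebra.lift k (universalMatrix π n) (f ⟨j - 1, by omega⟩)).mulVec
      (universalVector π n) i)

/-- The open subset of `Rep × 𝔸^n` where some `D_f` does not vanish. -/
noncomputable def cyclicLocus (π : FreeAlgebra k (Fin m) →ₐ[k] A) (n : ℕ) :
    (Spec (CommRingCat.of (RepVecRing π n))).Opens :=
  ⨆ f : Fin (n - 1) → FreeAlgebra k (Fin m), PrimeSpectrum.basicOpen (cyclicDet π n f)

/-- The open subscheme of `Rep × 𝔸^n` that is the union of the loci `D_f ≠ 0`, as a `k`-scheme. -/
noncomputable def basedHilbertScheme (π : FreeAlgebra k (Fin m) →ₐ[k] A) (n : ℕ) : Sch k :=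
  Over.mk ((cyclicLocus π n).ι ≫ Spec.map (CommRingCat.ofHom (algebraMap k (RepVecRing π n))))

end

end BasedHilb

open BasedHilb

/-! The basis B makes a triple rigid. In coordinates M is 𝒪_X^n, A acts through a k-algebra map σ
from A to n × n matrices over Γ(X, 𝒪_X), and v is a column of global functions. An equivalence
carries basis to basis, so in coordinates it is the identity: a class of triples is the same thing
as a pair (σ, v) for which v generates. Without the generation condition, such pairs are exactly the
k-algebra maps from `RepVecRing π n` to Γ(X, 𝒪_X) (`exists_eq_repVecHom`, `repVecHom_injective`),
that is, the k-morphisms from X to Rep × 𝔸^n.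

Generation is governed by determinants. If v generates, then at every point x the vectors σ(a)v span
the fibre (`Triple.span_evaluation_eq_top`); so n - 1 of them complete v to a basis of the fibre,
and some D_f does not vanish at x. Conversely, where some D_f is invertible, its columns are a basis
of 𝒪_X^n made of multiples of v, so v generates there (`matrixModule_generates`). Hence the
generating pairs are the morphisms that land in the union of the loci D_f ≠ 0.

Representability follows by embedding both sides, the morphisms to the scheme and the classes of
triples, into the k-algebra maps `RepVecRing π n` → Γ(X, 𝒪_X). The two images are cut out by the
same condition (`exists_homToSections_eq_iff`, `exists_toSections_eq_iff`), and both embeddings are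
compatible with pullback.

For quasi-affineness and finite type the point is that a union over infinitely many f is
quasi-compact. Over a residue field K, the span of the vectors w(A_1, …, A_m)v with w a word of
length less than i grows strictly with i until it is stable, so it is all of K^n by i = n if it ever
is (`span_monomial_mulVec_eq_top`). Thus the finitely many D_f with entries of f words of length
less than n already cover (`iSup_basicOpen_krylovDet`). -/

namespace BasedHilb

/-! ### Cyclic vectors over a field -/

section LinearAlgebra

/-- The `n × n` matrix with columns `v, w_0, …, w_{n-2}`. -/
def consColumns {B : Type*} {n : ℕ} (v : Fin n → B) (w : Fin (n - 1) → Fin n → B) :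
    Matrix (Fin n) (Fin n) B :=
  Matrix.of fun i j => if h : (j : ℕ) = 0 then v i else w ⟨j - 1, by omega⟩ i

theorem consColumns_map {B C : Type*} {n : ℕ} (φ : B → C) (v : Fin n → B)
    (w : Fin (n - 1) → Fin n → B) :
    (consColumns v w).map φ = consColumns (φ ∘ v) (fun i => φ ∘ w i) := by
  ext i j
  simp only [consColumns, Matrix.map_apply, Matrix.of_apply]
  split_ifs <;> rfl

theorem consColumns_col_mem {B : Type*} {n : ℕ} {v : Fin n → B} {w : Fin (n - 1) → Fin n → B}
    {S : Set (Fin n → B)} (hv : v ∈ S) (hw : ∀ i, w i ∈ S) (j : Fin n) :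
    (consColumns v w).col j ∈ S := by
  by_cases h : (j : ℕ) = 0
  · have : (consColumns v w).col j = v := by
      ext i
      simp [consColumns, Matrix.col, h]
    rwa [this]
  · have : (consColumns v w).col j = w ⟨j - 1, by omega⟩ := by
      ext i
      simp [consColumns, Matrix.col, h]
    rw [this]
    exact hw _

variable {K : Type*} [Field K] {n : ℕ}

/-- Columns from a spanning set that contains `v ≠ 0` can be chosen to complete `v` to a basis. -/
theorem exists_det_consColumns_ne_zero {S : Set (Fin n → K)} {v : Fin n → K} (hv : v ∈ S)
    (hv0 : v ≠ 0) (hS : Submodule.span K S = ⊤) :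
    ∃ w : Fin (n - 1) → Fin n → K, (∀ i, w i ∈ S) ∧ (consColumns v w).det ≠ 0 := by
  have hn : 0 < n := by
    rcases Nat.eq_zero_or_pos n with rfl | h
    · exact (hv0 (Subsingleton.elim _ _)).elim
    · exact h
  have hli : LinearIndepOn K id ({v} : Set (Fin n → K)) := LinearIndepOn.singleton hv0
  have hsub : {v} ⊆ S := Set.singleton_subset_iff.2 hv
  -- Extend {v} to a basis inside the spanning set S.
  let b := Module.Basis.extendLe hli hsub hS.ge
  have hvb : v ∈ hli.extend hsub := hli.subset_extend hsub rfl
  let e₀ : hli.extend hsub ≃ Fin n := b.indexEquiv (Pi.basisFun K (Fin n))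
  -- The transposition moves v to index 0, where the first column sits.
  let e : Fin n ≃ hli.extend hsub :=
    (Equiv.swap ⟨0, hn⟩ (e₀ ⟨v, hvb⟩)).trans e₀.symm
  have he : (e ⟨0, hn⟩ : Fin n → K) = v := by simp [e]
  have hb : LinearIndependent K fun j => (e j : Fin n → K) := by
    have h := (b.reindex e.symm).linearIndependent
    convert! h using 2 with j
    simp [b]
  refine ⟨fun i => e ⟨i + 1, by omega⟩, fun i => hli.extend_subset hsub (e _).2, ?_⟩
  have hcol : (consColumns v fun i : Fin (n - 1) => (e ⟨i + 1, by omega⟩ : Fin n → K)).col =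
      fun j => (e j : Fin n → K) := by
    funext j i
    by_cases h : (j : ℕ) = 0
    · have hj : j = ⟨0, hn⟩ := Fin.ext h
      rw [hj, he]
      simp [consColumns, Matrix.col]
    · have hj : (⟨(j : ℕ) - 1 + 1, by omega⟩ : Fin n) = j := Fin.ext (by simp; omega)
      simp [consColumns, Matrix.col, h, hj]
  have hu := (Matrix.linearIndependent_cols_iff_isUnit.1 (hcol ▸ hb))
  exact ((Matrix.isUnit_iff_isUnit_det _).1 hu).ne_zero

/-- The columns are n linearly independent vectors of K^n, and all of them lie in S. -/
theorem span_eq_top_of_det_consColumns_ne_zero {S : Set (Fin n → K)} {v : Fin n → K}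
    {w : Fin (n - 1) → Fin n → K} (hv : v ∈ S) (hw : ∀ i, w i ∈ S)
    (h : (consColumns v w).det ≠ 0) : Submodule.span K S = ⊤ := by
  have hli := Matrix.linearIndependent_cols_iff_isUnit.2
    ((Matrix.isUnit_iff_isUnit_det _).2 (isUnit_iff_ne_zero.2 h))
  rw [eq_top_iff, ← hli.span_eq_top_of_card_eq_finrank' (by simp)]
  exact Submodule.span_mono (Set.range_subset_iff.2 (consColumns_col_mem hv hw))

theorem ne_zero_of_span_mulVec_eq_top {ι : Type*} (hn : 1 ≤ n)
    {P : ι → Matrix (Fin n) (Fin n) K} {v : Fin n → K}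
    (h : Submodule.span K (Set.range fun p => (P p).mulVec v) = ⊤) : v ≠ 0 := by
  rintro rfl
  have : Nonempty (Fin n) := ⟨⟨0, hn⟩⟩
  refine bot_ne_top (α := Submodule K (Fin n → K)) (h ▸ ?_)
  refine (Submodule.span_eq_bot.2 ?_).symm
  rintro _ ⟨p, rfl⟩
  exact Matrix.mulVec_zero _

variable {k : Type*} [CommRing k] [Algebra k K] {m : ℕ}

/-- The monomial `x_{l_0} x_{l_1} ⋯` in the free algebra. -/
def monomial (k : Type*) [CommRing k] {m : ℕ} (l : List (Fin m)) : FreeAlgebra k (Fin m) :=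
  (l.map (FreeAlgebra.ι k)).prod

/-- If all `p(A_1, …, A_m) v` span `K^n`, then so do those where `p` is a monomial of degree
less than `n`. -/
theorem span_monomial_mulVec_eq_top (hn : 1 ≤ n)
    (P : FreeAlgebra k (Fin m) →ₐ[k] Matrix (Fin n) (Fin n) K) (v : Fin n → K)
    (h : Submodule.span K (Set.range fun p => (P p).mulVec v) = ⊤) :
    Submodule.span K ((fun l => (P (monomial k l)).mulVec v) '' {l | l.length < n}) = ⊤ := by
  -- Filtration by word length. W 0 = 0, and v enters in W 1 through the empty word; this is why 0 <
  -- i is required below.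
  let W : ℕ → Submodule K (Fin n → K) := fun i =>
    Submodule.span K ((fun l => (P (monomial k l)).mulVec v) '' {l | l.length < i})
  have hvW : ∀ i, 0 < i → v ∈ W i := fun i hi =>
    Submodule.subset_span ⟨[], hi, by simp [monomial]⟩
  have hmono : ∀ i, W i ≤ W (i + 1) := fun i =>
    Submodule.span_mono (Set.image_mono fun l (hl : l.length < i) =>
      show l.length < i + 1 by omega)
  have hstep : ∀ i (s : Fin m), ∀ z ∈ W i, (P (FreeAlgebra.ι k s)).mulVec z ∈ W (i + 1) := by
    intro i s z hz
    induction hz using Submodule.span_induction with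
    | mem z hz =>
      obtain ⟨l, hl, rfl⟩ := hz
      refine Submodule.subset_span ⟨s :: l, show (s :: l).length < i + 1 by simpa using hl, ?_⟩
      simp [monomial]
    | zero => rw [Matrix.mulVec_zero]; exact zero_mem _
    | add x y _ _ hx hy => rw [Matrix.mulVec_add]; exact add_mem hx hy
    | smul c x _ hx => rw [Matrix.mulVec_smul]; exact Submodule.smul_mem _ c hx
  -- Once the filtration stops growing, W i is stable under every generator, hence under the whole
  -- free algebra. It contains v, so it contains every P(p)v.
  have hstable : ∀ i, 0 < i → W (i + 1) ≤ W i → W i = ⊤ := by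
    intro i hi hle
    have key : ∀ p, ∀ z ∈ W i, (P p).mulVec z ∈ W i := by
      intro p
      induction p using FreeAlgebra.induction with
      | grade0 r =>
        intro z hz
        rw [AlgHom.commutes, IsScalarTower.algebraMap_apply k K, Algebra.algebraMap_eq_smul_one,
          Matrix.smul_mulVec, Matrix.one_mulVec]
        exact Submodule.smul_mem _ _ hz
      | grade1 s => exact fun z hz => hle (hstep i s z hz)
      | mul a b ha hb =>
        intro z hz
        rw [map_mul, ← Matrix.mulVec_mulVec]
        exact ha _ (hb z hz)
      | add a b ha hb =>
        intro z hz
        rw [map_add, Matrix.add_mulVec]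
        exact add_mem (ha z hz) (hb z hz)
    rw [eq_top_iff, ← h, Submodule.span_le]
    rintro _ ⟨p, rfl⟩
    exact key p v (hvW i hi)
  have hv0 : v ≠ 0 := ne_zero_of_span_mulVec_eq_top hn h
  -- Each strict inclusion adds at least one dimension, starting from W 1, which contains v ≠ 0. At
  -- i = n both alternatives give the whole space.
  have hdim : ∀ i, 0 < i → W i = ⊤ ∨ i ≤ Module.finrank K (W i) := by
    intro i hi
    induction i, hi using Nat.le_induction with
    | base =>
      refine Or.inr ?_
      rw [Submodule.one_le_finrank_iff]
      intro h0
      exact hv0 (by simpa [h0] using hvW 1 one_pos)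
    | succ i hi ih =>
      by_cases ht : W i = ⊤
      · exact Or.inl (top_le_iff.1 (ht ▸ hmono i))
      · have hlt : W i < W (i + 1) :=
          lt_of_le_not_ge (hmono i) fun hle => ht (hstable i hi hle)
        exact Or.inr ((ih.resolve_left ht).trans_lt (Submodule.finrank_lt_finrank_of_lt hlt))
  rcases hdim n hn with h | h
  · exact h
  · refine Submodule.eq_top_of_finrank_eq (le_antisymm (Submodule.finrank_le _) ?_)
    simpa using h

end LinearAlgebra

/-! ### Finitely many determinants suffice -/

section KrylovDet
variable {k : Type*} [CommRing k] {R : Type*} [CommRing R] [Algebra k R] {m n : ℕ}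

/-- The determinant `det (v, f_1(M) v, …, f_{n-1}(M) v)`. -/
noncomputable def krylovDet (M : Fin m → Matrix (Fin n) (Fin n) R) (v : Fin n → R)
    (f : Fin (n - 1) → FreeAlgebra k (Fin m)) : R :=
  (consColumns v fun i => (FreeAlgebra.lift k M (f i)).mulVec v).det

theorem lift_map_matrix {B : Type*} [CommRing B] [Algebra k B] (ψ : R →ₐ[k] B)
    (M : Fin m → Matrix (Fin n) (Fin n) R) (p : FreeAlgebra k (Fin m)) :
    FreeAlgebra.lift k (fun s => (M s).map ψ) p = (FreeAlgebra.lift k M p).map ψ := by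
  have h : FreeAlgebra.lift k (fun s => (M s).map ψ) =
      ψ.mapMatrix.comp (FreeAlgebra.lift k M) := by
    ext s i j
    simp
  rw [h]
  rfl

/-- Compatibility with base change: it allows D_f to be evaluated in residue fields and in rings of
global sections. -/
theorem map_krylovDet {B : Type*} [CommRing B] [Algebra k B] (ψ : R →ₐ[k] B)
    (M : Fin m → Matrix (Fin n) (Fin n) R) (v : Fin n → R)
    (f : Fin (n - 1) → FreeAlgebra k (Fin m)) :
    ψ (krylovDet M v f) = krylovDet (fun s => (M s).map ψ) (ψ ∘ v) f := by
  rw [krylovDet, AlgHom.map_det, AlgHom.mapMatrix_apply, consColumns_map, krylovDet]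
  congr 2
  funext i j
  rw [lift_map_matrix]
  exact RingHom.map_mulVec ψ.toRingHom _ _ j

/-- The question is pointwise. If one determinant is nonzero in the residue field K at x, then the
translates of v span K^n. By the bound on word length those by short words span already, and n - 1
of them complete v to a basis, which is a nonvanishing determinant of the restricted kind. -/
theorem iSup_basicOpen_krylovDet (hn : 1 ≤ n) (M : Fin m → Matrix (Fin n) (Fin n) R)
    (v : Fin n → R) :
    (⨆ f : Fin (n - 1) → FreeAlgebra k (Fin m), PrimeSpectrum.basicOpen (krylovDet M v f)) =
      ⨆ l : Fin (n - 1) → {l : List (Fin m) | l.length < n},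
        PrimeSpectrum.basicOpen (krylovDet M v fun i => monomial k (l i : List (Fin m))) := by
  refine le_antisymm (fun x hx => ?_) (iSup_le fun l => le_iSup_of_le _ le_rfl)
  obtain ⟨f, hf⟩ := Opens.mem_iSup.1 hx
  let K := x.asIdeal.ResidueField
  let ψ : R →ₐ[k] K := IsScalarTower.toAlgHom k R K
  let P : FreeAlgebra k (Fin m) →ₐ[k] Matrix (Fin n) (Fin n) K :=
    FreeAlgebra.lift k (fun s => (M s).map ψ)
  have hD : ∀ g, x ∈ PrimeSpectrum.basicOpen (krylovDet M v g) ↔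
      (consColumns (ψ ∘ v) fun i => (P (g i)).mulVec (ψ ∘ v)).det ≠ 0 := by
    intro g
    rw [PrimeSpectrum.mem_basicOpen, ← Ideal.algebraMap_residueField_eq_zero]
    exact not_congr (Eq.congr_left (map_krylovDet ψ M v g))
  have hspan : Submodule.span K (Set.range fun p => (P p).mulVec (ψ ∘ v)) = ⊤ :=
    span_eq_top_of_det_consColumns_ne_zero ⟨1, by simp⟩ (fun i => ⟨f i, rfl⟩) ((hD f).1 hf)
  have hv0 := ne_zero_of_span_mulVec_eq_top hn hspan
  obtain ⟨w, hw, hdet⟩ := exists_det_consColumns_ne_zero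
    (show ψ ∘ v ∈ (fun l => (P (monomial k l)).mulVec (ψ ∘ v)) '' {l | l.length < n} from
      ⟨[], hn, by simp [monomial]⟩) hv0 (span_monomial_mulVec_eq_top hn P _ hspan)
  choose l hl hlw using hw
  refine Opens.mem_iSup.2 ⟨fun i => ⟨l i, hl i⟩, (hD _).2 ?_⟩
  rw [← funext hlw] at hdet
  exact hdet

/-- There are finitely many words of length less than n in m letters, so the union is a finite union
of basic opens. -/
theorem isCompact_iSup_basicOpen_krylovDet (hn : 1 ≤ n) (M : Fin m → Matrix (Fin n) (Fin n) R)
    (v : Fin n → R) :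
    IsCompact ((⨆ f : Fin (n - 1) → FreeAlgebra k (Fin m),
      PrimeSpectrum.basicOpen (krylovDet M v f) : Opens (PrimeSpectrum R)) :
        Set (PrimeSpectrum R)) := by
  have : Finite {l : List (Fin m) | l.length < n} := List.finite_length_lt (Fin m) n
  rw [iSup_basicOpen_krylovDet hn, Opens.coe_iSup]
  exact isCompact_iUnion fun l => PrimeSpectrum.isCompact_basicOpen _

theorem exists_surjective_freeAlgebra_fin (k A : Type*) [CommRing k] [Ring A]
    [Algebra k A] [h : Algebra.FiniteType k A] :
    ∃ (m : ℕ) (π : FreeAlgebra k (Fin m) →ₐ[k] A), Function.Surjective π := by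
  obtain ⟨ι, _, π, hπ⟩ := Algebra.FiniteType.iff_quotient_freeAlgebra'.1 h
  let e := Fintype.equivFin ι
  refine ⟨Fintype.card ι, FreeAlgebra.lift k (fun i => π (FreeAlgebra.ι k (e.symm i))), ?_⟩
  have h : (FreeAlgebra.lift k (fun i => π (FreeAlgebra.ι k (e.symm i)))).comp
      (FreeAlgebra.lift k fun j => FreeAlgebra.ι k (e j)) = π := by
    ext j
    simp
  intro a
  obtain ⟨p, rfl⟩ := hπ a
  exact ⟨_, DFunLike.congr_fun h p⟩

end KrylovDet

/-! ### Quasi-affineness and finite type of the scheme -/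

section
variable {k : Type u} [CommRing k] {A : Type u} [Ring A] [Algebra k A] {m : ℕ}

theorem cyclicDet_eq_krylovDet (π : FreeAlgebra k (Fin m) →ₐ[k] A) (n : ℕ)
    (f : Fin (n - 1) → FreeAlgebra k (Fin m)) :
    cyclicDet π n f = krylovDet (universalMatrix π n) (universalVector π n) f := rfl

theorem isCompact_cyclicLocus (π : FreeAlgebra k (Fin m) →ₐ[k] A) {n : ℕ} (hn : 1 ≤ n) :
    IsCompact (cyclicLocus π n : Set (Spec (CommRingCat.of (RepVecRing π n)))) :=
  isCompact_iSup_basicOpen_krylovDet (k := k) hn (universalMatrix π n) (universalVector π n)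

theorem isQuasiAffine_of_isCompact {R : CommRingCat.{u}} {U : (Spec R).Opens}
    (hU : IsCompact (U : Set (Spec R))) : U.toScheme.IsQuasiAffine := by
  have : CompactSpace U.toScheme := isCompact_iff_compactSpace.1 hU
  exact Scheme.IsQuasiAffine.of_isImmersion U.ι

theorem quasiCompact_of_isCompact {R S : CommRingCat.{u}} {U : (Spec R).Opens}
    (hU : IsCompact (U : Set (Spec R))) (g : Spec R ⟶ Spec S) : QuasiCompact (U.ι ≫ g) := by
  have : CompactSpace U.toScheme := isCompact_iff_compactSpace.1 hU
  exact (quasiCompact_iff_compactSpace (U.ι ≫ g)).2 this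

theorem isQuasiAffine_basedHilbertScheme (π : FreeAlgebra k (Fin m) →ₐ[k] A) {n : ℕ}
    (hn : 1 ≤ n) : (basedHilbertScheme π n).left.IsQuasiAffine :=
  isQuasiAffine_of_isCompact (isCompact_cyclicLocus π hn)

theorem quasiCompact_basedHilbertScheme (π : FreeAlgebra k (Fin m) →ₐ[k] A) {n : ℕ}
    (hn : 1 ≤ n) : QuasiCompact (basedHilbertScheme π n).hom :=
  quasiCompact_of_isCompact (isCompact_cyclicLocus π hn) _

instance finiteType_repVecRing (π : FreeAlgebra k (Fin m) →ₐ[k] A) (n : ℕ) :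
    Algebra.FiniteType k (RepVecRing π n) :=
  Algebra.FiniteType.trans (S := RepRing π n) inferInstance inferInstance

theorem locallyOfFiniteType_basedHilbertScheme (π : FreeAlgebra k (Fin m) →ₐ[k] A) (n : ℕ) :
    LocallyOfFiniteType (basedHilbertScheme π n).hom := by
  have aux : ∀ (R : Type u) [CommRing R] [Algebra k R] [Algebra.FiniteType k R]
      (U : (Spec (CommRingCat.of R)).Opens),
      LocallyOfFiniteType (U.ι ≫ Spec.map (CommRingCat.ofHom (algebraMap k R))) := by
    intro R _ _ h U
    have : LocallyOfFiniteType (Spec.map (CommRingCat.ofHom (algebraMap k R))) := by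
      rw [HasRingHomProperty.Spec_iff (P := @LocallyOfFiniteType)]
      exact RingHom.finiteType_algebraMap.2 h
    infer_instance
  exact aux (RepVecRing π n) (cyclicLocus π n)

end

/-! ### The universal property of Rep × 𝔸^n -/

section
variable {k : Type*} [CommRing k] {F A C : Type*} [Ring F] [Algebra k F] [Ring A] [Algebra k A]
  [Ring C] [Algebra k C]

theorem exists_algHom_comp_eq (π : F →ₐ[k] A) (hπ : Function.Surjective π) (g : F →ₐ[k] C)
    (h : ∀ p, π p = 0 → g p = 0) : ∃ σ : A →ₐ[k] C, ∀ p, σ (π p) = g p := by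
  let s := Function.surjInv hπ
  -- The value of g on a preimage of a does not depend on the preimage. So g after the set-theoretic
  -- section s respects all operations, although s need not.
  have hg : ∀ a p, π p = a → g (s a) = g p := by
    intro a p hp
    rw [← sub_eq_zero, ← map_sub]
    exact h _ (by rw [map_sub, Function.surjInv_eq hπ, hp, sub_self])
  have hs : ∀ a, π (s a) = a := Function.surjInv_eq hπ
  refine ⟨AlgHom.ofLinearMap
    { toFun := fun a => g (s a)
      map_add' := fun a b => by rw [hg _ (s a + s b) (by simp [hs]), map_add]
      map_smul' := fun c a => by rw [hg _ (c • s a) (by simp [hs]), map_smul]; rfl }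
    ((hg _ 1 (map_one π)).trans (map_one g))
    (fun a b => (hg _ (s a * s b) (by simp [hs])).trans (map_mul g _ _)), fun p => hg _ p rfl⟩

end

section
variable {k : Type u} [CommRing k] {A : Type u} [Ring A] [Algebra k A] {m n : ℕ}
  (π : FreeAlgebra k (Fin m) →ₐ[k] A) {B : Type u} [CommRing B] [Algebra k B]

/-- Both sides are algebra maps in p that agree on the generators. For p in the kernel of π the
right side is 0, which is why specialization of the generic matrices factors through `RepRing π n`.
-/
theorem lift_entries_eq (σ : A →ₐ[k] Matrix (Fin n) (Fin n) B) (p : FreeAlgebra k (Fin m)) :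
    (FreeAlgebra.lift k (genericMatrix k m n) p).map
      (MvPolynomial.aeval (R := k) fun t : Fin m × Fin n × Fin n =>
        σ (π (FreeAlgebra.ι k t.1)) t.2.1 t.2.2) = σ (π p) := by
  rw [← lift_map_matrix]
  refine DFunLike.congr_fun (show FreeAlgebra.lift k _ = σ.comp π from ?_) p
  ext s i j
  simp [genericMatrix]

/-- The map `k[Rep] → B` that classifies a matrix representation of `A` over `B`. -/
noncomputable def repHom (σ : A →ₐ[k] Matrix (Fin n) (Fin n) B) : RepRing π n →ₐ[k] B :=
  Ideal.Quotient.liftₐ (repIdeal π n)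
    (MvPolynomial.aeval fun t : Fin m × Fin n × Fin n =>
      σ (π (FreeAlgebra.ι k t.1)) t.2.1 t.2.2) (by
    have h : repIdeal π n ≤ RingHom.ker (MvPolynomial.aeval (R := k)
        fun t : Fin m × Fin n × Fin n => σ (π (FreeAlgebra.ι k t.1)) t.2.1 t.2.2) := by
      refine Ideal.span_le.2 ?_
      rintro _ ⟨r, hr, i, j, rfl⟩
      refine (congrFun (congrFun (lift_entries_eq π σ r) i) j).trans ?_
      rw [hr, map_zero]
      rfl
    exact fun p hp => h hp)

/-- The map `k[Rep × 𝔸^n] → B` that classifies a matrix representation of `A` over `B` together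
with a vector. -/
noncomputable def repVecHom (σ : A →ₐ[k] Matrix (Fin n) (Fin n) B) (v : Fin n → B) :
    RepVecRing π n →ₐ[k] B :=
  MvPolynomial.aevalTower (repHom π σ) v

theorem repVecHom_universalVector (σ : A →ₐ[k] Matrix (Fin n) (Fin n) B) (v : Fin n → B) :
    repVecHom π σ v ∘ universalVector π n = v :=
  funext fun i => MvPolynomial.aevalTower_X _ _ i

theorem repVecHom_universalMatrix (σ : A →ₐ[k] Matrix (Fin n) (Fin n) B) (v : Fin n → B)
    (s : Fin m) :
    (universalMatrix π n s).map (repVecHom π σ v) = σ (π (FreeAlgebra.ι k s)) := by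
  ext i j
  refine (MvPolynomial.aevalTower_C (repHom π σ) v _).trans ?_
  refine (Ideal.Quotient.lift_mk _ _ _).trans ?_
  exact MvPolynomial.aeval_X _ _

/-- The entries of the universal matrices and vector generate the ring over k. -/
theorem repVecRing_hom_ext {φ φ' : RepVecRing π n →ₐ[k] B}
    (hM : ∀ s, (universalMatrix π n s).map φ = (universalMatrix π n s).map φ')
    (hv : φ ∘ universalVector π n = φ' ∘ universalVector π n) : φ = φ' := by
  refine AlgHom.coe_ringHom_injective (MvPolynomial.ringHom_ext' ?_ fun i => congrFun hv i)
  refine Ideal.Quotient.ringHom_ext (MvPolynomial.ringHom_ext' ?_ ?_)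
  · ext r
    exact (φ.commutes r).trans (φ'.commutes r).symm
  · rintro ⟨s, i, j⟩
    exact congrFun (congrFun (hM s) i) j

/-- Naturality in the coefficient ring, the source of compatibility with pullback of triples. -/
theorem comp_repVecHom {B' : Type u} [CommRing B'] [Algebra k B'] (ψ : B →ₐ[k] B')
    (σ : A →ₐ[k] Matrix (Fin n) (Fin n) B) (v : Fin n → B) :
    ψ.comp (repVecHom π σ v) = repVecHom π (ψ.mapMatrix.comp σ) (ψ ∘ v) := by
  refine repVecRing_hom_ext π (fun s => ?_) ?_
  · rw [repVecHom_universalMatrix, AlgHom.coe_comp, ← Matrix.map_map, repVecHom_universalMatrix]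
    rfl
  · rw [repVecHom_universalVector, AlgHom.coe_comp, Function.comp_assoc,
      repVecHom_universalVector]

theorem lift_universalMatrix_eq_zero {r : FreeAlgebra k (Fin m)} (hr : π r = 0) :
    FreeAlgebra.lift k (universalMatrix π n) r = 0 := by
  let q : MvPolynomial (Fin m × Fin n × Fin n) k →ₐ[k] RepVecRing π n :=
    (IsScalarTower.toAlgHom k (RepRing π n) (RepVecRing π n)).comp
      (Ideal.Quotient.mkₐ k (repIdeal π n))
  have h : FreeAlgebra.lift k (universalMatrix π n) r =
      (FreeAlgebra.lift k (genericMatrix k m n) r).map q := by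
    rw [← lift_map_matrix (B := RepVecRing π n)]
    rfl
  rw [h]
  refine Matrix.ext fun i j => ?_
  have h0 : Ideal.Quotient.mk (repIdeal π n)
      (FreeAlgebra.lift k (genericMatrix k m n) r i j) = 0 :=
    Ideal.Quotient.eq_zero_iff_mem.2 (Ideal.subset_span ⟨r, hr, i, j, rfl⟩)
  exact (congrArg (algebraMap (RepRing π n) (RepVecRing π n)) h0).trans (map_zero _)

variable {π} in
-- The images under φ of the universal matrices satisfy all relations of A, so the representation of
-- the free algebra they define descends along π.
theorem exists_eq_repVecHom (hπ : Function.Surjective π) (φ : RepVecRing π n →ₐ[k] B) :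
    ∃ (σ : A →ₐ[k] Matrix (Fin n) (Fin n) B) (v : Fin n → B), φ = repVecHom π σ v := by
  obtain ⟨σ, hσ⟩ := exists_algHom_comp_eq π hπ
    (φ.mapMatrix.comp (FreeAlgebra.lift k (universalMatrix π n))) (fun r hr => by
      rw [AlgHom.comp_apply, lift_universalMatrix_eq_zero π hr, map_zero])
  refine ⟨σ, φ ∘ universalVector π n, repVecRing_hom_ext π (fun s => ?_) ?_⟩
  · rw [repVecHom_universalMatrix, hσ]
    simp
  · rw [repVecHom_universalVector]

variable {π} in
theorem repVecHom_injective (hπ : Function.Surjective π)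
    {σ σ' : A →ₐ[k] Matrix (Fin n) (Fin n) B} {v v' : Fin n → B}
    (h : repVecHom π σ v = repVecHom π σ' v') : σ = σ' ∧ v = v' := by
  constructor
  · have h' : σ.comp π = σ'.comp π := by
      ext s : 2
      refine (repVecHom_universalMatrix π σ v s).symm.trans ?_
      rw [h]
      exact repVecHom_universalMatrix π σ' v' s
    ext1 a
    obtain ⟨p, rfl⟩ := hπ a
    exact DFunLike.congr_fun h' p
  · rw [← repVecHom_universalVector π σ v, h, repVecHom_universalVector]

/-- This translates the locus D_f ≠ 0 into a condition on the pair (σ, v) alone. -/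
theorem repVecHom_cyclicDet (σ : A →ₐ[k] Matrix (Fin n) (Fin n) B) (v : Fin n → B)
    (f : Fin (n - 1) → FreeAlgebra k (Fin m)) :
    repVecHom π σ v (cyclicDet π n f) =
      (consColumns v fun i => (σ (π (f i))).mulVec v).det := by
  rw [cyclicDet_eq_krylovDet]
  refine (map_krylovDet (R := RepVecRing π n) (repVecHom π σ v) _ _ f).trans ?_
  rw [repVecHom_universalVector, funext (repVecHom_universalMatrix π σ v)]
  have h : FreeAlgebra.lift k (fun s => σ (π (FreeAlgebra.ι k s))) = σ.comp π := by
    ext s : 2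
    simp
  rw [krylovDet, h]
  rfl

end

/-! ### Morphisms to an open subscheme of Spec R -/

section
variable {k : Type u} [CommRing k] {R : Type u} [CommRing R] [Algebra k R]
  (U : (Spec (CommRingCat.of R)).Opens)

variable (k) in
/-- An open subscheme of `Spec R`, as a `k`-scheme. -/
noncomputable def openSubscheme : Sch k :=
  Over.mk (U.ι ≫ Spec.map (CommRingCat.ofHom (algebraMap k R)))

variable {U}

/-- Together with `eq_toSpecΓ_SpecMap`, this is the bijection between ring maps R → Γ(X, 𝒪_X) and
morphisms X → Spec R. -/
theorem toSpecΓ_SpecMap_sections {X : Scheme.{u}} {R : CommRingCat.{u}} (φ : R ⟶ Γ(X, ⊤)) :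
    (Scheme.ΓSpecIso R).inv ≫ (X.toSpecΓ ≫ Spec.map φ).appTop = φ := by
  rw [Scheme.Hom.comp_appTop, ← Scheme.ΓSpecIso_inv_naturality_assoc, Scheme.toSpecΓ_appTop,
    Iso.inv_hom_id, Category.comp_id]

theorem eq_toSpecΓ_SpecMap {X : Scheme.{u}} {R : CommRingCat.{u}} (g : X ⟶ Spec R) :
    g = X.toSpecΓ ≫ Spec.map ((Scheme.ΓSpecIso R).inv ≫ g.appTop) :=
  ext_to_Spec (R := R) (toSpecΓ_SpecMap_sections _).symm

theorem structureMap_top (X : Sch k) :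
    structureMap X ⊤ = ((Scheme.ΓSpecIso (CommRingCat.of k)).inv ≫ X.hom.appTop).hom := by
  have h : X.left.presheaf.map (homOfLE (le_top : (⊤ : X.left.Opens) ≤ ⊤)).op = 𝟙 _ :=
    X.left.presheaf.map_id _
  rw [structureMap, h, Category.comp_id]

theorem sections_comp_algebraMap {X : Sch k} (g : X.left ⟶ Spec (CommRingCat.of R))
    (hg : g ≫ Spec.map (CommRingCat.ofHom (algebraMap k R)) = X.hom) (r : k) :
    ((Scheme.ΓSpecIso (CommRingCat.of R)).inv ≫ g.appTop).hom (algebraMap k R r) =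
      structureMap X ⊤ r := by
  rw [structureMap_top, ← hg, Scheme.Hom.comp_appTop, ← Scheme.ΓSpecIso_inv_naturality_assoc]
  rfl

/-- The map `R → 𝒪_X(X)` given by a morphism from `X` to an open subscheme of `Spec R`. -/
noncomputable def homToSections {X : Sch k} (g : X ⟶ openSubscheme k U) :
    R →ₐ[k] Γ(X.left, ⊤) where
  __ := ((Scheme.ΓSpecIso (CommRingCat.of R)).inv ≫
    Scheme.Hom.appTop (show X.left ⟶ Spec (CommRingCat.of R) from g.left ≫ U.ι)).hom
  commutes' r := sections_comp_algebraMap (g.left ≫ U.ι)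
    ((Category.assoc _ _ _).trans (Over.w g)) r

theorem homToSections_comp {X Y : Sch k} (f : Y ⟶ X) (g : X ⟶ openSubscheme k U) :
    homToSections (f ≫ g) = (pullbackSections f ⊤).comp (homToSections g) := by
  ext r
  have h : (show Y.left ⟶ Spec (CommRingCat.of R) from (f ≫ g).left ≫ U.ι) =
      f.left ≫ (show X.left ⟶ Spec (CommRingCat.of R) from g.left ≫ U.ι) :=
    Category.assoc f.left g.left U.ι
  change ((Scheme.ΓSpecIso (CommRingCat.of R)).inv ≫
    Scheme.Hom.appTop (show Y.left ⟶ Spec (CommRingCat.of R) from (f ≫ g).left ≫ U.ι)).hom r = _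
  rw [h]
  rfl

/-- The open immersion is a monomorphism, and a morphism to Spec R is determined by its effect on
global sections. -/
theorem homToSections_injective {X : Sch k} :
    Function.Injective (homToSections : (X ⟶ openSubscheme k U) → _) := by
  intro g g' h
  refine Over.OverMorphism.ext ((cancel_mono U.ι).1 (ext_to_Spec ?_))
  ext r
  exact DFunLike.congr_fun h r

/-- The map φ corresponds to q : X → Spec R, which factors through U exactly when its image lies in
U. The preimage under q of the basic open of `d i` is the basic open of `φ (d i)`. -/
theorem exists_homToSections_eq_iff {ι : Type*} {d : ι → R}
    (hU : U = ⨆ i, PrimeSpectrum.basicOpen (d i)) {X : Sch k} (φ : R →ₐ[k] Γ(X.left, ⊤)) :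
    (∃ g : X ⟶ openSubscheme k U, homToSections g = φ) ↔
      ∀ x : X.left, ∃ i, x ∈ X.left.basicOpen (φ (d i)) := by
  let Φ : CommRingCat.of R ⟶ Γ(X.left, ⊤) := CommRingCat.ofHom φ.toRingHom
  let q : X.left ⟶ Spec (CommRingCat.of R) := X.left.toSpecΓ ≫ Spec.map Φ
  have hpre : ∀ i x, q x ∈ (PrimeSpectrum.basicOpen (d i) : (Spec (CommRingCat.of R)).Opens) ↔
      x ∈ X.left.basicOpen (φ (d i)) := by
    intro i x
    rw [← Scheme.toSpecΓ_preimage_basicOpen]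
    rfl
  have hmem : ∀ x, q x ∈ U ↔ ∃ i, x ∈ X.left.basicOpen (φ (d i)) := by
    intro x
    simp only [← hpre]
    rw [hU]
    exact Opens.mem_iSup
  simp only [← hmem]
  constructor
  · rintro ⟨g, rfl⟩ x
    have hq : q = g.left ≫ U.ι :=
      (eq_toSpecΓ_SpecMap (R := CommRingCat.of R) (g.left ≫ U.ι)).symm
    rw [hq]
    exact (g.left x).2
  · intro h
    have hr : Set.range q ⊆ Set.range U.ι := by
      rintro _ ⟨x, rfl⟩
      rw [Scheme.Opens.range_ι]
      exact h x
    -- Because φ is k-linear, q is a morphism over Spec k.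
    have hw : q ≫ Spec.map (CommRingCat.ofHom (algebraMap k R)) = X.hom := by
      rw [eq_toSpecΓ_SpecMap X.hom, Category.assoc, ← Spec.map_comp]
      congr 2
      ext r
      refine (φ.commutes r).trans ?_
      exact congrArg (fun z : k →+* Γ(X.left, ⊤) => z r) (structureMap_top X)
    let l : X.left ⟶ U.toScheme := IsOpenImmersion.lift U.ι q hr
    have hl : l ≫ U.ι = q := IsOpenImmersion.lift_fac U.ι q hr
    refine ⟨Over.homMk l ?_, ?_⟩
    · exact (Category.assoc _ _ _).symm.trans ((congrArg (· ≫ _) hl).trans hw)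
    · ext r
      change ((Scheme.ΓSpecIso (CommRingCat.of R)).inv ≫ Scheme.Hom.appTop
        (show X.left ⟶ Spec (CommRingCat.of R) from l ≫ U.ι)).hom r = _
      rw [hl, toSpecΓ_SpecMap_sections]
      rfl
end

/-! ### Bases and determinants over a ring -/

section
variable {n : ℕ} {B : Type*} [CommRing B]

/-- Since N is invertible, c = N(N⁻¹c) is a linear combination of the columns. -/
theorem mem_of_isUnit_det {N : Matrix (Fin n) (Fin n) B} (hN : IsUnit N.det)
    {S : Submodule B (Fin n → B)} (hS : ∀ j, N.col j ∈ S) (c : Fin n → B) : c ∈ S := by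
  have h1 : c = N.mulVec (N⁻¹.mulVec c) := by
    rw [Matrix.mulVec_mulVec, Matrix.mul_nonsing_inv N hN, Matrix.one_mulVec]
  rw [h1, Matrix.mulVec_eq_sum]
  refine sum_mem fun j _ => ?_
  rw [op_smul_eq_smul]
  exact S.smul_mem _ (hS j)

/-- The identity matrix in the family puts v itself among the spanning vectors, so v can serve as
first column. The remaining columns are then chosen over K from images of vectors over B. -/
theorem exists_map_det_ne_zero {K ι : Type*} [Field K] (hn : 1 ≤ n) (ev : B →+* K)
    (M : ι → Matrix (Fin n) (Fin n) B) (v : Fin n → B) {i₀ : ι} (h₀ : M i₀ = 1)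
    (h : Submodule.span K (Set.range fun i => ((M i).map ev).mulVec (ev ∘ v)) = ⊤) :
    ∃ a : Fin (n - 1) → ι, ev (consColumns v fun i => (M (a i)).mulVec v).det ≠ 0 := by
  obtain ⟨w, hw, hdet⟩ := exists_det_consColumns_ne_zero 
    (show ev ∘ v ∈ Set.range fun i => ((M i).map ev).mulVec (ev ∘ v) from ⟨i₀, by simp [h₀]⟩)
    (ne_zero_of_span_mulVec_eq_top hn h) h
  choose a ha using hw
  refine ⟨a, ?_⟩
  rw [RingHom.map_det, RingHom.mapMatrix_apply, consColumns_map]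
  have : (fun i => ev ∘ (M (a i)).mulVec v) = w := by
    funext i
    rw [← ha]
    funext j
    exact RingHom.map_mulVec ev _ _ j
  rwa [this]

end

/-! ### Triples in coordinates and fibrewise generation -/

section
variable {k : Type u} [CommRing k] {A : Type u} [Ring A] [Algebra k A] {n : ℕ}

/-- A map that respects the bases acts on coordinates as f^#. Hence the matrices and the coordinates
of v pull back entrywise. -/
theorem Triple.coord_hom {X Y : Sch k} {f : Y ⟶ X} {T : Triple A n X} {T' : Triple A n Y}
    (g : T.M ⟶ pushforwardModule f T'.M)
    (hB : ∀ i, (g.val.app (op ⊤)).hom (T.B i) = T'.B i) (m : T.M.val.obj (op ⊤)) :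
    T'.coord ⊤ ((g.val.app (op ⊤)).hom m) = fun i => f.left.app ⊤ (T.coord ⊤ m i) := by
  have h : (g.val.app (op ⊤)).hom m =
      combination T'.M T'.B ⊤ (fun i => f.left.app ⊤ (T.coord ⊤ m i)) := by
    conv_lhs => rw [← T.combination_coord ⊤ m]
    refine (hom_combination g T.B ⊤ _).trans ?_
    rw [funext hB]
    exact combination_pushforward f T'.M T'.B ⊤ _
  exact (congrArg (T'.coord ⊤) h).trans (T'.coord_combination ⊤ _)

theorem Triple.IsOver.matrixHom_eq {X Y : Sch k} {f : Y ⟶ X} {T : Triple A n X}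
    {T' : Triple A n Y} (h : T.IsOver f T') :
    T'.matrixHom = (pullbackSections f ⊤).mapMatrix.comp T.matrixHom := by
  obtain ⟨g, -, hB⟩ := h
  ext a i j
  change T'.coord ⊤ (fromAlgebra A Y ⊤ a • T'.B j) i =
    f.left.app ⊤ (T.coord ⊤ (fromAlgebra A X ⊤ a • T.B j) i)
  refine Eq.trans ?_ (congrFun (T.coord_hom g hB (fromAlgebra A X ⊤ a • T.B j)) i)
  rw [← hB]
  refine congrArg (fun z => T'.coord ⊤ z i) ?_
  refine Eq.symm ((map_smul (g.val.app (op ⊤)).hom _ _).trans ?_)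
  exact pushforwardModule_fromAlgebra_smul f T'.M ⊤ a _

theorem Triple.IsOver.coord_eq {X Y : Sch k} {f : Y ⟶ X} {T : Triple A n X}
    {T' : Triple A n Y} (h : T.IsOver f T') :
    T'.coord ⊤ T'.v = pullbackSections f ⊤ ∘ T.coord ⊤ T.v := by
  obtain ⟨g, hv, hB⟩ := h
  rw [← hv]
  exact T.coord_hom g hB T.v

/-- The map that keeps coordinates and exchanges the bases is linear over A because the matrices
agree, hence linear over A_X. Bijectivity is automatic, since basis goes to basis. -/
theorem Triple.isEquivalent_of_matrixHom_eq {X : Sch k} {T T' : Triple A n X}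
    (hσ : T.matrixHom = T'.matrixHom) (hv : T.coord ⊤ T.v = T'.coord ⊤ T'.v) :
    T.IsEquivalent T' := by
  have hm : ∀ a, T.matrix a = T'.matrix a := DFunLike.congr_fun hσ
  refine Triple.isEquivalent_of_hom (mkHom T.M T'.M
    (fun U => (combination T'.M T'.B U).comp (T.coord U).toAddMonoidHom) ?_ ?_ ?_) ?_ ?_
  · intro U V h m
    exact (congrArg (combination T'.M T'.B V) (T.coord_restrict h m)).trans
      (restrict_combination T'.M T'.B h _).symm
  · intro U s m
    exact (congrArg (combination T'.M T'.B U) (T.coord_fromFunctions_smul U s m)).trans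
      (combination_smul T'.M T'.B U s _)
  · intro U a m
    refine (congrArg (combination T'.M T'.B U) (T.coord_fromAlgebra_smul U a m)).trans ?_
    rw [hm]
    exact (fromAlgebra_smul_combination T'.M T'.B a _ (T'.fromAlgebra_smul_basis a) U _).symm
  · exact (congrArg (combination T'.M T'.B ⊤) hv).trans (T'.combination_coord ⊤ T'.v)
  · intro i
    exact (congrArg (combination T'.M T'.B ⊤) (T.coord_basis i)).trans
      (combination_single T'.M T'.B i)

theorem evaluation_restrict (X : Scheme.{u}) {U V : X.Opens} (h : V ≤ U) (x : X) (hx : x ∈ V)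
    (s : Γ(X, U)) :
    X.evaluation V x hx (X.presheaf.map (homOfLE h).op s) = X.evaluation U x (h hx) s := by
  rw [← Scheme.germ_residue, ← Scheme.germ_residue, CommRingCat.comp_apply,
    CommRingCat.comp_apply, X.presheaf.germ_res_apply]

/-- A section of a sheafification comes locally from the presheaf. -/
theorem exists_toAlgebraSheaf_eq (X : Sch k) {U : X.left.Opens}
    (r : (algebraSheaf A X).obj.obj (op U)) (x : X.left) (hx : x ∈ U) :
    ∃ (V : X.left.Opens) (h : V ≤ U) (t : Γ(X.left, V) ⊗[k] A), x ∈ V ∧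
      ((toAlgebraSheaf A X).app (op V)).hom t = (algebraSheaf A X).obj.map (homOfLE h).op r := by
  have hloc : Presheaf.IsLocallySurjective (Opens.grothendieckTopology X.left)
      (toAlgebraSheaf A X) :=
    inferInstanceAs (Presheaf.IsLocallySurjective (Opens.grothendieckTopology X.left)
      (toSheafify (Opens.grothendieckTopology X.left) (presheafTensor A X)))
  obtain ⟨V, i, ⟨t, ht⟩, hxV⟩ :=
    Presheaf.imageSieve_mem (Opens.grothendieckTopology X.left) (toAlgebraSheaf A X) r x hx
  exact ⟨V, i.le, t, hxV, ht⟩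

theorem Triple.coord_toAlgebraSheaf_smul_mem {X : Sch k} (T : Triple A n X) (V : X.left.Opens)
    (t : Γ(X.left, V) ⊗[k] A) (m : T.M.val.obj (op V)) :
    T.coord V (((toAlgebraSheaf A X).app (op V)).hom t • m) ∈
      Submodule.span Γ(X.left, V) (Set.range fun a =>
        ((T.matrix a).map (X.left.presheaf.map (homOfLE (le_top : V ≤ ⊤)).op)).mulVec
          (T.coord V m)) := by
  induction t using TensorProduct.induction_on with
  | zero =>
    have h0 : ((toAlgebraSheaf A X).app (op V)).hom (0 : Γ(X.left, V) ⊗[k] A) = 0 :=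
      map_zero ((toAlgebraSheaf A X).app (op V)).hom
    rw [h0, zero_smul, map_zero]
    exact zero_mem _
  | tmul s a =>
    have h0 := toAlgebraSheaf_tmul (A := A) X V s a
    erw [h0]
    rw [mul_smul, T.coord_fromFunctions_smul, T.coord_fromAlgebra_smul]
    exact Submodule.smul_mem _ _ (Submodule.subset_span ⟨a, rfl⟩)
  | add x y hx hy =>
    have h0 : ((toAlgebraSheaf A X).app (op V)).hom (x + y : Γ(X.left, V) ⊗[k] A) =
        ((toAlgebraSheaf A X).app (op V)).hom x + ((toAlgebraSheaf A X).app (op V)).hom y :=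
      map_add ((toAlgebraSheaf A X).app (op V)).hom x y
    rw [h0, add_smul, map_add]
    exact add_mem hx hy

/-- The vectors `a v`, `a ∈ A`, span the fibre of `M` at every point. -/
theorem Triple.span_evaluation_eq_top {X : Sch k} (T : Triple A n X) (x : X.left) :
    Submodule.span (X.left.residueField x) (Set.range fun a : A =>
      ((T.matrix a).map (X.left.Γevaluation x)).mulVec
        (fun j => X.left.Γevaluation x (T.coord ⊤ T.v j))) = ⊤ := by
  set W := Submodule.span (X.left.residueField x) (Set.range fun a : A =>
      ((T.matrix a).map (X.left.Γevaluation x)).mulVec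
        (fun j => X.left.Γevaluation x (T.coord ⊤ T.v j))) with hW
  -- It suffices to reach the standard basis vectors, the values at x of the basis sections. Near x
  -- each `T.B i` is a multiple of v, and after shrinking the multiplier comes from 𝒪_X ⊗ A.
  have key : ∀ i, (Pi.single i 1 : Fin n → X.left.residueField x) ∈ W := by
    intro i
    obtain ⟨V, hV, r, hxV, hr⟩ := T.generates ⊤ (T.B i) x trivial
    obtain ⟨V', hV', t, hxV', ht⟩ := exists_toAlgebraSheaf_eq X r x hxV
    have h1 : ((toAlgebraSheaf A X).app (op V')).hom t • restrict T.M (le_top : V' ≤ ⊤) T.v =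
        restrict T.M (le_top : V' ≤ ⊤) (T.B i) := by
      rw [ht, ← restrict_restrict T.M hV hV' (T.B i), ← hr, restrict_smul, restrict_restrict]
    have h2 := T.coord_toAlgebraSheaf_smul_mem V' t (restrict T.M le_top T.v)
    rw [h1] at h2
    let ev : Γ(X.left, V') →+* X.left.residueField x := (X.left.evaluation V' x hxV').hom
    have hev : ∀ s : Γ(X.left, ⊤),
        ev (X.left.presheaf.map (homOfLE (le_top : V' ≤ ⊤)).op s) = X.left.Γevaluation x s :=
      fun s => evaluation_restrict X.left le_top x hxV' s
    -- Evaluation at x is semilinear, so it carries the span over Γ(V') into the span over the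
    -- residue field.
    have h3 : ∀ c ∈ Submodule.span Γ(X.left, V') (Set.range fun a =>
        ((T.matrix a).map (X.left.presheaf.map (homOfLE (le_top : V' ≤ ⊤)).op)).mulVec
          (T.coord V' (restrict T.M le_top T.v))), (ev ∘ c) ∈ W := by
      intro c hc
      induction hc using Submodule.span_induction with
      | mem c hc =>
        obtain ⟨a, rfl⟩ := hc
        refine Submodule.subset_span ⟨a, ?_⟩
        funext j
        refine Eq.symm ((RingHom.map_mulVec ev _ _ j).trans ?_)
        rw [T.coord_restrict]
        refine congrFun (congrArg₂ Matrix.mulVec (Matrix.ext fun p q => hev _)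
          (funext fun p => hev _)) j
      | zero =>
        have : ev ∘ (0 : Fin n → Γ(X.left, V')) = 0 := funext fun _ => map_zero ev
        rw [this]
        exact zero_mem _
      | add c d _ _ hc hd =>
        have : ev ∘ (c + d) = ev ∘ c + ev ∘ d := funext fun _ => map_add ev _ _
        rw [this]
        exact add_mem hc hd
      | smul s c _ hc =>
        have : ev ∘ (s • c) = ev s • (ev ∘ c) := funext fun _ => map_mul ev _ _
        rw [this]
        exact Submodule.smul_mem _ _ hc
    have h4 := h3 _ h2
    rw [T.coord_restrict, T.coord_basis] at h4
    convert h4 using 1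
    funext j
    refine Eq.symm ((hev _).trans ?_)
    rw [Pi.single_apply, Pi.single_apply]
    split_ifs
    · exact map_one (X.left.Γevaluation x).hom
    · exact map_zero (X.left.Γevaluation x).hom
  rw [eq_top_iff, ← (Pi.basisFun (X.left.residueField x) (Fin n)).span_eq, Submodule.span_le]
  rintro _ ⟨i, rfl⟩
  rw [Pi.basisFun_apply]
  exact key i

theorem Triple.exists_mem_basicOpen {X : Sch k} (hn : 1 ≤ n) (T : Triple A n X) (x : X.left) :
    ∃ a : Fin (n - 1) → A, x ∈ X.left.basicOpen
      (consColumns (T.coord ⊤ T.v) fun i => (T.matrix (a i)).mulVec (T.coord ⊤ T.v)).det := by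
  let ev : Γ(X.left, ⊤) →+* X.left.residueField x := (X.left.Γevaluation x).hom
  obtain ⟨a, ha⟩ := exists_map_det_ne_zero hn ev T.matrix (T.coord ⊤ T.v) T.matrix_one
    (T.span_evaluation_eq_top x)
  exact ⟨a, (Scheme.evaluation_ne_zero_iff_mem_basicOpen X.left x
    (show x ∈ (⊤ : X.left.Opens) from trivial) _).1 ha⟩

end

/-! ### From a cyclic pair to a triple -/

section
variable {k : Type u} [CommRing k] {A : Type u} [Ring A] [Algebra k A] {n : ℕ} {X : Sch k}

/-- If the determinant of `v, σ(a_1) v, …, σ(a_{n-1}) v` is invertible near `x`, then `v` generates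
`𝒪_X^n` near `x`. -/
theorem matrixModule_generates (σ : A →ₐ[k] Matrix (Fin n) (Fin n) Γ(X.left, ⊤))
    (v : Fin n → Γ(X.left, ⊤))
    (h : ∀ x : X.left, ∃ a : Fin (n - 1) → A, x ∈ X.left.basicOpen
      (consColumns v fun i => (σ (a i)).mulVec v).det)
    (U : X.left.Opens) (m : (matrixModule σ).val.obj (op U)) (x : X.left) (hx : x ∈ U) :
    ∃ (V : X.left.Opens) (hV : V ≤ U) (a : (algebraSheaf A X).obj.obj (op V)),
      x ∈ V ∧ a • restrict (matrixModule σ) (le_top : V ≤ ⊤)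
        (show (matrixModule σ).val.obj (op ⊤) from v) = restrict (matrixModule σ) hV m := by
  obtain ⟨a, ha⟩ := h x
  let D := (consColumns v fun i => (σ (a i)).mulVec v).det
  -- On this neighbourhood of x the determinant becomes a unit.
  let V : X.left.Opens := U ⊓ X.left.basicOpen D
  have hV : V ≤ U := inf_le_left
  let res : Γ(X.left, ⊤) →+* Γ(X.left, V) :=
    (X.left.presheaf.map (homOfLE (le_top : V ≤ ⊤)).op).hom
  have hunit : IsUnit (res D) := by
    have h1 := X.left.toRingedSpace.isUnit_res_basicOpen D
    have h2 := h1.map (X.left.presheaf.map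
      (homOfLE (inf_le_right : V ≤ X.left.basicOpen D)).op).hom
    convert h2 using 1
    exact ConcreteCategory.congr_hom (X.left.presheaf.map_comp
      (homOfLE (le_top : X.left.basicOpen D ≤ ⊤)).op
      (homOfLE (inf_le_right : V ≤ X.left.basicOpen D)).op) D
  let N := (consColumns v fun i => (σ (a i)).mulVec v).map res
  have hN : IsUnit N.det := by
    have : N.det = res D := (RingHom.map_det res _).symm
    rwa [this]
  -- S consists of the multiples of v over V. It contains the columns v and σ(a_i)v of N, and N is
  -- invertible, so S is everything.
  let S : Submodule Γ(X.left, V) (Fin n → Γ(X.left, V)) :=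
    { carrier := {c | ∃ r : (algebraSheaf A X).obj.obj (op V),
        (toMatrix σ V r).mulVec (res ∘ v) = c}
      zero_mem' := ⟨0, by rw [map_zero, Matrix.zero_mulVec]⟩
      add_mem' := by
        rintro _ _ ⟨r, rfl⟩ ⟨r', rfl⟩
        exact ⟨r + r', by rw [map_add, Matrix.add_mulVec]⟩
      smul_mem' := by
        rintro s _ ⟨r, rfl⟩
        exact ⟨fromFunctions A X V s * r, by
          rw [map_mul, toMatrix_fromFunctions, Matrix.smul_mul, Matrix.one_mul,
            Matrix.smul_mulVec]⟩ }
  have hcol : ∀ j, N.col j ∈ S := by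
    have hN' : N = consColumns (res ∘ v) fun i => res ∘ (σ (a i)).mulVec v :=
      consColumns_map res _ _
    rw [hN']
    refine consColumns_col_mem (S := (S : Set (Fin n → Γ(X.left, V)))) ?_ fun i => ?_
    · exact ⟨1, by rw [map_one, Matrix.one_mulVec]⟩
    · refine ⟨fromAlgebra A X V (a i), ?_⟩
      rw [toMatrix_fromAlgebra]
      funext j
      exact (RingHom.map_mulVec res _ _ j).symm
  let c : Fin n → Γ(X.left, V) := restrict (matrixModule σ) hV m
  obtain ⟨r, hr⟩ := mem_of_isUnit_det hN hcol c
  exact ⟨V, hV, r, ⟨hx, ha⟩, hr⟩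

/-- The triple given by a matrix representation and a cyclic vector. -/
noncomputable def matrixTriple (σ : A →ₐ[k] Matrix (Fin n) (Fin n) Γ(X.left, ⊤))
    (v : Fin n → Γ(X.left, ⊤))
    (h : ∀ x : X.left, ∃ a : Fin (n - 1) → A, x ∈ X.left.basicOpen
      (consColumns v fun i => (σ (a i)).mulVec v).det) : Triple A n X where
  M := matrixModule σ
  v := v
  B := standardBasis σ
  basis U := by
    have h : ⇑(combination (matrixModule σ) (standardBasis σ) U) = id :=
      funext (combination_standardBasis σ U)
    change Function.Bijective (combination (matrixModule σ) (standardBasis σ) U)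
    rw [h]
    exact Function.bijective_id
  generates := matrixModule_generates σ v h

theorem matrixTriple_coord (σ : A →ₐ[k] Matrix (Fin n) (Fin n) Γ(X.left, ⊤))
    (v : Fin n → Γ(X.left, ⊤)) (h) (c : Fin n → Γ(X.left, ⊤)) :
    (matrixTriple σ v h).coord ⊤ c = c := by
  refine (congrArg ((matrixTriple σ v h).coord ⊤) (combination_standardBasis σ ⊤ c).symm).trans ?_
  exact (matrixTriple σ v h).coord_combination ⊤ c

theorem matrixTriple_matrixHom (σ : A →ₐ[k] Matrix (Fin n) (Fin n) Γ(X.left, ⊤))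
    (v : Fin n → Γ(X.left, ⊤)) (h) : (matrixTriple σ v h).matrixHom = σ := by
  ext a i j
  refine (congrFun (matrixTriple_coord σ v h _) i).trans ?_
  refine (congrFun (matrixModule_smul σ ⊤ (fromAlgebra A X ⊤ a) (Pi.single j 1)) i).trans ?_
  rw [toMatrix_fromAlgebra, Matrix.mulVec_single_one]
  exact ConcreteCategory.congr_hom (X.left.presheaf.map_id (op ⊤)) (σ a i j)

end

/-! ### Representability -/

section
variable {k : Type u} [CommRing k] {A : Type u} [Ring A] [Algebra k A] {m n : ℕ}
  (π : FreeAlgebra k (Fin m) →ₐ[k] A)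

/-- The map `k[Rep × 𝔸^n] → 𝒪_X(X)` given by a triple over `X`. -/
noncomputable def Triple.toSections {X : Sch k} (T : Triple A n X) :
    RepVecRing π n →ₐ[k] Γ(X.left, ⊤) :=
  repVecHom π T.matrixHom (T.coord ⊤ T.v)

theorem Triple.IsOver.toSections_eq {X Y : Sch k} {f : Y ⟶ X} {T : Triple A n X}
    {T' : Triple A n Y} (h : T.IsOver f T') :
    T'.toSections π = (pullbackSections f ⊤).comp (T.toSections π) := by
  rw [Triple.toSections, Triple.toSections, h.matrixHom_eq, h.coord_eq]
  exact (comp_repVecHom π (pullbackSections f ⊤) T.matrixHom (T.coord ⊤ T.v)).symm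

variable {π}

/-- The matrices and the coordinates of the generator form a complete invariant. Invariance under
equivalence is the pullback formula for the identity morphism. -/
theorem Triple.toSections_eq_iff (hπ : Function.Surjective π) {X : Sch k} {T T' : Triple A n X} :
    T.toSections π = T'.toSections π ↔ T.IsEquivalent T' := by
  refine ⟨fun h => ?_, fun h => ?_⟩
  · obtain ⟨h1, h2⟩ := repVecHom_injective hπ h
    exact Triple.isEquivalent_of_matrixHom_eq h1 h2
  · exact ((Triple.IsOver.of_isEquivalent h T'.isOver_id).toSections_eq π).symm

/-- Every φ comes from a pair (σ, v), and the condition on the D_f says that v generates.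
Surjectivity of π lets elements of A be replaced by noncommutative polynomials f. -/
theorem exists_toSections_eq_iff (hn : 1 ≤ n) (hπ : Function.Surjective π) {X : Sch k}
    (φ : RepVecRing π n →ₐ[k] Γ(X.left, ⊤)) :
    (∃ T : Triple A n X, T.toSections π = φ) ↔
      ∀ x : X.left, ∃ f, x ∈ X.left.basicOpen (φ (cyclicDet π n f)) := by
  constructor
  · rintro ⟨T, rfl⟩ x
    obtain ⟨a, ha⟩ := T.exists_mem_basicOpen hn x
    choose f hf using fun i => hπ (a i)
    refine ⟨f, ?_⟩
    rw [Triple.toSections, repVecHom_cyclicDet]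
    simp only [hf]
    exact ha
  · intro h
    obtain ⟨σ, v, rfl⟩ := exists_eq_repVecHom hπ φ
    have h' : ∀ x : X.left, ∃ a : Fin (n - 1) → A, x ∈ X.left.basicOpen
        (consColumns v fun i => (σ (a i)).mulVec v).det := by
      intro x
      obtain ⟨f, hf⟩ := h x
      rw [repVecHom_cyclicDet] at hf
      exact ⟨_, hf⟩
    refine ⟨matrixTriple σ v h', ?_⟩
    rw [Triple.toSections, matrixTriple_matrixHom]
    exact congrArg _ (matrixTriple_coord σ v h' v)

/-- A morphism to the based Hilbert scheme and a class of triples correspond to each other if they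
give the same map on `k[Rep × 𝔸^n]`. -/
theorem nonempty_representableBy (hn : 1 ≤ n) (hπ : Function.Surjective π) :
    Nonempty ((basedHilbertFunctor k A n).RepresentableBy (basedHilbertScheme π n)) := by
  let Φ (X : Sch k) (g : X ⟶ basedHilbertScheme π n) : RepVecRing π n →ₐ[k] Γ(X.left, ⊤) :=
    homToSections (U := cyclicLocus π n) g
  let Ψ (X : Sch k) : (basedHilbertFunctor k A n).obj (op X) →
      (RepVecRing π n →ₐ[k] Γ(X.left, ⊤)) :=
    Quotient.lift (Triple.toSections π) fun _ _ h => (Triple.toSections_eq_iff hπ).2 h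
  have hΦ : ∀ X, Function.Injective (Φ X) := fun X =>
    homToSections_injective (U := cyclicLocus π n)
  have hΨ : ∀ X, Function.Injective (Ψ X) := by
    rintro X ⟨T⟩ ⟨T'⟩ h
    exact Quotient.sound ((Triple.toSections_eq_iff hπ).1 h)
  -- Both images consist of the φ for which every point of X lies in the basic open of some `φ
  -- (cyclicDet π n f)`.
  have hrange : ∀ X, Set.range (Φ X) = Set.range (Ψ X) := by
    intro X
    ext φ
    refine (exists_homToSections_eq_iff (U := cyclicLocus π n) (d := cyclicDet π n) rfl φ).trans
      ((exists_toSections_eq_iff hn hπ φ).symm.trans ⟨?_, ?_⟩)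
    · rintro ⟨T, hT⟩
      exact ⟨Quotient.mk _ T, hT⟩
    · rintro ⟨⟨T⟩, hT⟩
      exact ⟨T, hT⟩
  let e (X : Sch k) : (X ⟶ basedHilbertScheme π n) ≃ (basedHilbertFunctor k A n).obj (op X) :=
    (Equiv.ofInjective _ (hΦ X)).trans
      ((Equiv.setCongr (hrange X)).trans (Equiv.ofInjective _ (hΨ X)).symm)
  have he : ∀ X g, Ψ X (e X g) = Φ X g := fun X g =>
    congrArg Subtype.val ((Equiv.ofInjective _ (hΨ X)).apply_symm_apply
      (Equiv.setCongr (hrange X) (Equiv.ofInjective _ (hΦ X) g)))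
  have hΨmap : ∀ {X Y : Sch k} (f : Y ⟶ X) (z : (basedHilbertFunctor k A n).obj (op X)),
      Ψ Y ((basedHilbertFunctor k A n).map f.op z) = (pullbackSections f ⊤).comp (Ψ X z) := by
    rintro X Y f ⟨T⟩
    exact (T.isOver_pullback f).toSections_eq π
  -- Naturality is checked after the injection Ψ, where both sides become composition with the
  -- pullback of global sections.
  refine ⟨{ homEquiv := fun {X} => e X, homEquiv_comp := fun {X X'} f g => hΨ X ?_ }⟩
  rw [he, hΨmap, he]
  exact homToSections_comp (U := cyclicLocus π n) f g

end

end BasedHilb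

theorem mainTheorem1 (k : Type u) [CommRing k] (A : Type u) [Ring A] [Algebra k A]
    [Algebra.FiniteType k A] (n : ℕ) (hn : 1 ≤ n) :
    (∃ H : Sch k, Nonempty ((basedHilbertFunctor k A n).RepresentableBy H) ∧
      H.left.IsQuasiAffine ∧
      (IsNoetherianRing k → LocallyOfFiniteType H.hom ∧ QuasiCompact H.hom)) ∧
    ∀ (m : ℕ) (π : FreeAlgebra k (Fin m) →ₐ[k] A), Function.Surjective π →
      Nonempty ((basedHilbertFunctor k A n).RepresentableBy (basedHilbertScheme π n)) ∧
      (basedHilbertScheme π n).left.IsQuasiAffine ∧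
      (IsNoetherianRing k → LocallyOfFiniteType (basedHilbertScheme π n).hom ∧
        QuasiCompact (basedHilbertScheme π n).hom) := by
  have main : ∀ (m : ℕ) (π : FreeAlgebra k (Fin m) →ₐ[k] A), Function.Surjective π →
      Nonempty ((basedHilbertFunctor k A n).RepresentableBy (basedHilbertScheme π n)) ∧
      (basedHilbertScheme π n).left.IsQuasiAffine ∧
      (IsNoetherianRing k → LocallyOfFiniteType (basedHilbertScheme π n).hom ∧
        QuasiCompact (basedHilbertScheme π n).hom) := fun m π hπ =>
    ⟨nonempty_representableBy hn hπ, isQuasiAffine_basedHilbertScheme π hn, fun _ =>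
      ⟨locallyOfFiniteType_basedHilbertScheme π n, quasiCompact_basedHilbertScheme π hn⟩⟩
  -- Existence of a representing scheme is the explicit statement for one presentation, supplied by
  -- finite generation of A.
  obtain ⟨m, π, hπ⟩ := exists_surjective_freeAlgebra_fin k A
  exact ⟨⟨_, main m π hπ⟩, main⟩
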